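/- Gerrymandering over Graphs is the following decision problem. The input is a connected undirected graph $G=(V,E)$, vertex weights $w\colon V\to\mathbb N=\{0,1,2,\dots\}$, a finite set $C$ of colors, a target color $p\in C$, a coloring $\mathrm{col}\colon V\to C$, and a natural number $k$. A set $A\subseteq V$ is $q$-colored if $\sum_{v\in A,\,\mathrm{col}(v)=q}w(v)\ge\sum_{v\in A,\,\mathrm{col}(v)=r}w(v)$ for every $r\in C$, and uniquely $q$-colored if this inequality is strict for every $r\in C\setminus\{q\}$. The question is whether $V$ can be partitioned into exactly $k$ non-empty sets, each inducing a connected subgraph of $G$, such that for every color $r\in C\setminus\{p\}$ the number of uniquely $p$-colored parts exceeds the number of $r$-colored parts. Restricted to inputs in which $G$ is a tree of diameter three, this problem is solvable in $O(|C|^2\cdot n^5)$ time, where $n=|V|$: there are a program for a unit-cost random access machine (with addition, truncated subtraction, comparison and indirect addressing on natural numbers as elementary steps) and a constant $K$ such that on every such input, given by $n$, $|C|$, $p$, $k$, the weights, the colors and the adjacency matrix, the program halts with the correct answer after at most $K\cdot|C|^2\cdot n^5$ steps. -/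

import Mathlib

/-! A random access machine with unit-cost steps: finitely many registers (those named by the
program) and an infinite memory, both holding natural numbers. -/

namespace RAM

/-- The contents of the registers and of the memory. -/
structure State where
  reg : ℕ → ℕ
  mem : ℕ → ℕ

/-- The elementary instructions. Subtraction is truncated at zero; there is no multiplication. -/
inductive Instr where
  /-- `reg d := c` -/
  | const (d c : ℕ)
  /-- `reg d := reg a` -/
  | copy (d a : ℕ)
  /-- `reg d := reg a + reg b` -/
  | add (d a b : ℕ)
  /-- `reg d := reg a - reg b` -/
  | sub (d a b : ℕ)
  /-- `reg d := mem (reg a)` -/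
  | load (d a : ℕ)
  /-- `mem (reg a) := reg b` -/
  | store (a b : ℕ)

/-- The effect of an elementary instruction. -/
def Instr.exec : Instr → State → State
  | .const d c, s => { s with reg := Function.update s.reg d c }
  | .copy d a, s => { s with reg := Function.update s.reg d (s.reg a) }
  | .add d a b, s => { s with reg := Function.update s.reg d (s.reg a + s.reg b) }
  | .sub d a b, s => { s with reg := Function.update s.reg d (s.reg a - s.reg b) }
  | .load d a, s => { s with reg := Function.update s.reg d (s.mem (s.reg a)) }
  | .store a b, s => { s with mem := Function.update s.mem (s.reg a) (s.reg b) }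

/-- The elementary tests: comparison of two registers. -/
inductive Test where
  /-- `reg a < reg b` -/
  | lt (a b : ℕ)
  /-- `reg a = reg b` -/
  | eq (a b : ℕ)

/-- The outcome of a test. -/
def Test.Holds : Test → State → Prop
  | .lt a b, s => s.reg a < s.reg b
  | .eq a b, s => s.reg a = s.reg b

/-- Programs. -/
inductive Prog where
  | skip
  | instr (i : Instr)
  | seq (P Q : Prog)
  | ite (b : Test) (P Q : Prog)
  | while (b : Test) (P : Prog)

/-- `Runs P s t s'`: started in state `s`, the program `P` halts in state `s'` after exactly `t`
steps, where each elementary instruction (also `skip`) and each evaluation of a test is one step. -/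
inductive Runs : Prog → State → ℕ → State → Prop where
  | skip (s : State) : Runs .skip s 1 s
  | instr (i : Instr) (s : State) : Runs (.instr i) s 1 (i.exec s)
  | seq {P Q : Prog} {s s' s'' : State} {t t' : ℕ} :
      Runs P s t s' → Runs Q s' t' s'' → Runs (.seq P Q) s (t + t') s''
  | ite_true {b : Test} {P Q : Prog} {s s' : State} {t : ℕ} :
      b.Holds s → Runs P s t s' → Runs (.ite b P Q) s (t + 1) s'
  | ite_false {b : Test} {P Q : Prog} {s s' : State} {t : ℕ} :
      ¬ b.Holds s → Runs Q s t s' → Runs (.ite b P Q) s (t + 1) s'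
  | while_true {b : Test} {P : Prog} {s s' s'' : State} {t t' : ℕ} :
      b.Holds s → Runs P s t s' → Runs (.while b P) s' t' s'' →
        Runs (.while b P) s (t + t' + 1) s''
  | while_false {b : Test} {P : Prog} {s : State} :
      ¬ b.Holds s → Runs (.while b P) s 1 s

/-- A run is determined by the program and the initial state. -/
theorem Runs.deterministic {P : Prog} {s s₁ s₂ : State} {t₁ t₂ : ℕ}
    (h₁ : Runs P s t₁ s₁) (h₂ : Runs P s t₂ s₂) : t₁ = t₂ ∧ s₁ = s₂ := by
  induction h₁ generalizing t₂ s₂ with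
  | skip s => cases h₂; exact ⟨rfl, rfl⟩
  | instr i s => cases h₂; exact ⟨rfl, rfl⟩
  | seq _ _ ih ih' =>
    cases h₂ with
    | seq a b =>
      obtain ⟨rfl, rfl⟩ := ih a
      obtain ⟨rfl, rfl⟩ := ih' b
      exact ⟨rfl, rfl⟩
  | ite_true h _ ih =>
    cases h₂ with
    | ite_true _ a => obtain ⟨rfl, rfl⟩ := ih a; exact ⟨rfl, rfl⟩
    | ite_false h' _ => exact absurd h h'
  | ite_false h _ ih =>
    cases h₂ with
    | ite_true h' _ => exact absurd h' h
    | ite_false _ a => obtain ⟨rfl, rfl⟩ := ih a; exact ⟨rfl, rfl⟩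
  | while_true h _ _ ih ih' =>
    cases h₂ with
    | while_true _ a b =>
      obtain ⟨rfl, rfl⟩ := ih a
      obtain ⟨rfl, rfl⟩ := ih' b
      exact ⟨rfl, rfl⟩
    | while_false h' => exact absurd h h'
  | while_false h =>
    cases h₂ with
    | while_true h' _ _ => exact absurd h' h
    | while_false _ => exact ⟨rfl, rfl⟩

/-- The initial state on a given input: the input is written at the beginning of the memory;
all registers and all other memory cells are zero. -/
def initial (input : List ℕ) : State where
  reg := fun _ => 0
  mem := fun a => input.getD a 0

/-- On the given input, the program halts within `T` steps, and leaves in register `0` the value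
`1` if the answer is yes, and the value `0` if it is no. -/
def AnswersWithin (P : Prog) (input : List ℕ) (answer : Prop) (T : ℕ) : Prop :=
  ∃ (t : ℕ) (s : State), t ≤ T ∧ Runs P (initial input) t s ∧
    ((answer ∧ s.reg 0 = 1) ∨ (¬ answer ∧ s.reg 0 = 0))

end RAM

namespace Gerrymandering

/-- An instance with vertex set `Fin n` and color set `Fin c` (without the requirement that the
graph is connected). -/
structure Instance (n c : ℕ) where
  /-- the graph -/
  G : SimpleGraph (Fin n)
  /-- the vertex weights -/
  w : Fin n → ℕ
  /-- the target color -/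
  p : Fin c
  /-- the coloring -/
  col : Fin n → Fin c
  /-- the required number of parts -/
  k : ℕ

variable {n c : ℕ}

/-- The total weight of the vertices of color `q` in `A`. -/
def Instance.colorWeight (I : Instance n c) (q : Fin c) (A : Finset (Fin n)) : ℕ :=
  ∑ v ∈ A with I.col v = q, I.w v

/-- `A` is `q`-colored. -/
def Instance.IsColored (I : Instance n c) (q : Fin c) (A : Finset (Fin n)) : Prop :=
  ∀ r : Fin c, I.colorWeight r A ≤ I.colorWeight q A

/-- `A` is uniquely `q`-colored. -/
def Instance.IsUniquelyColored (I : Instance n c) (q : Fin c) (A : Finset (Fin n)) : Prop :=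
  ∀ r : Fin c, r ≠ q → I.colorWeight r A < I.colorWeight q A

open Classical in
/-- The partition `𝒱` (into nonempty parts) is a solution: it has exactly `k` parts, each induces
a connected subgraph, and for each color `r ≠ p` there are more uniquely `p`-colored parts than
`r`-colored parts. -/
def Instance.IsSolution (I : Instance n c)
    (𝒱 : Finpartition (Finset.univ : Finset (Fin n))) : Prop :=
  𝒱.parts.card = I.k ∧
  (∀ A ∈ 𝒱.parts, (I.G.induce (A : Set (Fin n))).Connected) ∧
  ∀ r : Fin c, r ≠ I.p →
    (𝒱.parts.filter (fun A => I.IsColored r A)).card <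
      (𝒱.parts.filter (fun A => I.IsUniquelyColored I.p A)).card

/-- The instance is a yes-instance. -/
def Instance.IsYes (I : Instance n c) : Prop :=
  ∃ 𝒱 : Finpartition (Finset.univ : Finset (Fin n)), I.IsSolution 𝒱

open Classical in
/-- The instance as the input of a machine: the numbers `n`, `c`, `p`, `k`, then the weights of the
vertices, then their colors, then the adjacency matrix, row by row. -/
noncomputable def Instance.encode (I : Instance n c) : List ℕ :=
  [n, c, (I.p : ℕ), I.k] ++ List.ofFn I.w ++ List.ofFn (fun v => (I.col v : ℕ)) ++
    (List.ofFn fun u => List.ofFn fun v => if I.G.Adj u v then 1 else 0).flatten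

end Gerrymandering

/-! ### Expressions with bounded sums and their compilation -/

namespace RAM

/-! A tree of diameter three is a double star: two adjacent centers, every other vertex being a leaf
at one of them. A connected part avoiding both centers is a single leaf, so a partition amounts to a
set `S` of cut-off leaves together with the choice whether the centers stay in one part (`m = 1`) or
not (`m = 2`), subject to `#S + m = k` (`isYes_iff`). A cut-off leaf of positive weight counts for
its color; one of weight zero counts for every color and, if there are two colors, is not uniquely
colored.

Instead of `S`, one guesses for each remaining star `i` a vertex `v i`. Its color is meant to win
the star, by cutting off exactly those leaves of that color that precede `v i` in the order by
weight. For a given number of leaves, cutting the lightest ones keeps the largest weight, which is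
`top`. Any other color is brought down to `top` with the fewest cuts by removing its heaviest
leaves. This yields a least set `lo` and a greatest set `hi` for each color.

Ties are harmless for counting. As the leaves in question have positive weight, sparing a single
leaf of `mid` in a star may be traded for a tie there, which leaves the number of parts of that
color unchanged. So `#mid + ties` is a lower bound for the number of parts of a color `r ≠ p`
(`Describes.card_mid_le`), and conversely ties beyond `ties` are paid for by uncut leaves of `mid`
(`Respects.card_isCol_le`). Let `p` win `d + 1 + z` parts while `z` leaves of weight zero are cut
off; then every other color may have at most `d` parts apart from these leaves. Once `v`, `d` and
`z` are fixed, the colors are independent, the number of cut leaves of color `r` ranges from `#lo`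
to `min #hi (d - ties)`, and the total is attainable if and only if it lies between the sums of
these bounds. These are the inequalities of `IsCertificate`; the two directions are
`IsCertificate.exists_balanced` and `exists_isCertificate`.

For the running time, the search is written as an expression with sums over `n` or `c` values, an
existential quantifier being a sum that is positive. Compiled to loops, it costs at most a constant
times a power product of `n` and `c` whose exponents are the nesting depths of the sums (`cost_le`),
here at most five and two. -/

/-- Arithmetic expressions with bounded sums over the first two memory cells. Variables are
de Bruijn levels. -/
inductive Expr where
  | const (k : ℕ)
  | var (i : ℕ)
  | add (x y : Expr)
  | sub (x y : Expr)
  | mem (x : Expr)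
  /-- `if a < b then x else y` -/
  | ite (a b x y : Expr)
  /-- the sum of `x` over all values of the new variable below the content of cell `j` -/
  | sum (j : Bool) (x : Expr)
  | bind (x y : Expr)

namespace Expr

/-- The memory cell holding the bound of a sum. -/
def cell (j : Bool) : ℕ := if j then 1 else 0

/-- The value of an expression with free variables below `d`. -/
def eval (m : ℕ → ℕ) : Expr → ℕ → (ℕ → ℕ) → ℕ
  | const k, _, _ => k
  | var i, d, ρ => if i < d then ρ i else 0
  | add x y, d, ρ => eval m x d ρ + eval m y d ρ
  | sub x y, d, ρ => eval m x d ρ - eval m y d ρ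
  | mem x, d, ρ => m (eval m x d ρ)
  | ite a b x y, d, ρ =>
      if eval m a d ρ < eval m b d ρ then eval m x d ρ else eval m y d ρ
  | sum j x, d, ρ => ∑ i ∈ Finset.range (m (cell j)), eval m x (d + 1) (Function.update ρ d i)
  | bind x y, d, ρ => eval m y (d + 1) (Function.update ρ d (eval m x d ρ))

/-- Variables from `d` on evaluate to zero by definition. This permits a compiled subprogram to
overwrite the registers `2 * i` with `i ≥ d`. -/
theorem eval_congr (m : ℕ → ℕ) (x : Expr) : ∀ (d : ℕ) (ρ σ : ℕ → ℕ), (∀ i < d, ρ i = σ i) →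
    eval m x d ρ = eval m x d σ := by
  have upd : ∀ {d : ℕ} {ρ σ : ℕ → ℕ} (v : ℕ), (∀ i < d, ρ i = σ i) →
      ∀ i < d + 1, Function.update ρ d v i = Function.update σ d v i := by
    intro d ρ σ v h i hi
    by_cases hd : i = d
    · subst hd; simp
    · simp [hd, h i (by omega)]
  induction x with
  | const k => intros; rfl
  | var i =>
    intro d ρ σ h
    simp only [eval]
    split_ifs with hi
    · exact h i hi
    · rfl
  | add x y hx hy => intro d ρ σ h; simp only [eval, hx d ρ σ h, hy d ρ σ h]
  | sub x y hx hy => intro d ρ σ h; simp only [eval, hx d ρ σ h, hy d ρ σ h]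
  | mem x hx => intro d ρ σ h; simp only [eval, hx d ρ σ h]
  | ite a b x y ha hb hx hy =>
    intro d ρ σ h
    simp only [eval, ha d ρ σ h, hb d ρ σ h, hx d ρ σ h, hy d ρ σ h]
  | sum j x hx =>
    intro d ρ σ h
    simp only [eval]
    exact Finset.sum_congr rfl fun i _ => hx _ _ _ (upd i h)
  | bind x y hx hy =>
    intro d ρ σ h
    simp only [eval, hx d ρ σ h]
    exact hy _ _ _ (upd _ h)

/-- The body of the loop computing a sum. -/
def sumBody (body : Prog) (d t : ℕ) : Prog :=
  .seq body (.seq (.instr (.add (2 * t + 1) (2 * t + 1) (2 * (t + 3) + 1)))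
    (.instr (.add (2 * d) (2 * d) (2 * (t + 2) + 1))))

/-- Variable `i` is kept in register `2 * i`; the value is left in register `2 * t + 1`, and odd
registers from there on are used for intermediate results. -/
def compile : Expr → ℕ → ℕ → Prog
  | const k, _, t => .instr (.const (2 * t + 1) k)
  | var i, d, t =>
      if i < d then .instr (.copy (2 * t + 1) (2 * i)) else .instr (.const (2 * t + 1) 0)
  | add x y, d, t => .seq (compile x d t) (.seq (compile y d (t + 1))
      (.instr (.add (2 * t + 1) (2 * t + 1) (2 * (t + 1) + 1))))
  | sub x y, d, t => .seq (compile x d t) (.seq (compile y d (t + 1))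
      (.instr (.sub (2 * t + 1) (2 * t + 1) (2 * (t + 1) + 1))))
  | mem x, d, t => .seq (compile x d t) (.instr (.load (2 * t + 1) (2 * t + 1)))
  | ite a b x y, d, t => .seq (compile a d t) (.seq (compile b d (t + 1))
      (.ite (.lt (2 * t + 1) (2 * (t + 1) + 1)) (compile x d t) (compile y d t)))
  | sum j x, d, t =>
      .seq (.instr (.const (2 * t + 1) 0)) (.seq (.instr (.const (2 * (t + 1) + 1) (cell j)))
        (.seq (.instr (.load (2 * (t + 1) + 1) (2 * (t + 1) + 1)))
          (.seq (.instr (.const (2 * (t + 2) + 1) 1)) (.seq (.instr (.const (2 * d) 0))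
            (.while (.lt (2 * d) (2 * (t + 1) + 1)) (sumBody (compile x (d + 1) (t + 3)) d t))))))
  | bind x y, d, t => .seq (compile x d t) (.seq (.instr (.copy (2 * d) (2 * t + 1)))
      (compile y (d + 1) t))

/-- A bound on the number of steps, where `N false` and `N true` bound the sums. -/
def cost (N : Bool → ℕ) : Expr → ℕ
  | const _ => 1
  | var _ => 1
  | add x y => cost N x + cost N y + 1
  | sub x y => cost N x + cost N y + 1
  | mem x => cost N x + 1
  | ite a b x y => cost N a + cost N b + cost N x + cost N y + 1
  | sum j x => N j * (cost N x + 3) + 6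
  | bind x y => cost N x + cost N y + 1

/-- `s'` arises from `s` by a computation of the value `v` into register `2 * t + 1` that respects
the first `d` variables and the first `t` intermediate results. -/
structure Computed (d t v : ℕ) (s s' : State) : Prop where
  res : s'.reg (2 * t + 1) = v
  mem : s'.mem = s.mem
  even : ∀ i < d, s'.reg (2 * i) = s.reg (2 * i)
  odd : ∀ j < t, s'.reg (2 * j + 1) = s.reg (2 * j + 1)

/-- The variables of a state. -/
def vars (s : State) : ℕ → ℕ := fun i => s.reg (2 * i)

/-- The registers `2 * t + 1`, `2 * (t + 1) + 1` and `2 * (t + 2) + 1` hold the accumulator, the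
bound and the constant one; register `2 * d` is both the counter and the summation variable. The
induction is on the number `k` of remaining rounds, with arbitrary counter and accumulator. A round
costs three steps besides the body: a test and two additions. -/
theorem runs_sum_loop {body : Prog} {d t B C : ℕ} {m ρ : ℕ → ℕ} {g : ℕ → ℕ}
    (hbody : ∀ s : State, s.mem = m → (∀ i < d, vars s i = ρ i) →
      ∃ T s', Runs body s T s' ∧ T ≤ C ∧ Computed (d + 1) (t + 3) (g (s.reg (2 * d))) s s') :
    ∀ (k : ℕ) (s : State), s.mem = m → (∀ i < d, vars s i = ρ i) →
      s.reg (2 * (t + 1) + 1) = B → s.reg (2 * (t + 2) + 1) = 1 → s.reg (2 * d) + k = B →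
      ∃ T s', Runs (.while (.lt (2 * d) (2 * (t + 1) + 1)) (sumBody body d t)) s T s' ∧
        T ≤ k * (C + 3) + 1 ∧
        Computed d t (s.reg (2 * t + 1) + ∑ i ∈ Finset.range k, g (s.reg (2 * d) + i)) s s' := by
  intro k
  induction k with
  | zero =>
    intro s hm hρ hB h1 hk
    refine ⟨1, s, .while_false ?_, by omega, ?_, rfl, fun _ _ => rfl, fun _ _ => rfl⟩
    · simp only [Test.Holds]; omega
    · simp
  | succ k ih =>
    intro s hm hρ hB h1 hk
    obtain ⟨T, s₁, hr, hT, hc⟩ := hbody s hm hρ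
    set s₂ := (Instr.add (2 * t + 1) (2 * t + 1) (2 * (t + 3) + 1)).exec s₁ with hs₂
    set s₃ := (Instr.add (2 * d) (2 * d) (2 * (t + 2) + 1)).exec s₂ with hs₃
    have hev : ∀ i < d, s₃.reg (2 * i) = s.reg (2 * i) := by
      intro i hi
      have := hc.even i (by omega)
      simp only [hs₃, hs₂, Instr.exec, Function.update_apply]
      rw [if_neg (by omega), if_neg (by omega), this]
    have hd : s₃.reg (2 * d) = s.reg (2 * d) + 1 := by
      have h := hc.even d (by omega)
      have h' := hc.odd (t + 2) (by omega)
      simp only [hs₃, hs₂, Instr.exec, Function.update_apply]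
      rw [if_pos trivial, if_neg (by omega), if_neg (by omega), h, h', h1]
    have hod : ∀ j < t + 3, j ≠ t → s₃.reg (2 * j + 1) = s.reg (2 * j + 1) := by
      intro j hj hjt
      have := hc.odd j hj
      simp only [hs₃, hs₂, Instr.exec, Function.update_apply]
      rw [if_neg (by omega), if_neg (by omega), this]
    have hacc : s₃.reg (2 * t + 1) = s.reg (2 * t + 1) + g (s.reg (2 * d)) := by
      have := hc.odd t (by omega)
      simp only [hs₃, hs₂, Instr.exec, Function.update_apply]
      rw [if_neg (by omega), if_pos trivial, this, hc.res]
    have hmem : s₃.mem = s.mem := by simp only [hs₃, hs₂, Instr.exec]; exact hc.mem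
    obtain ⟨T', s', hr', hT', hc'⟩ := ih s₃ (hmem.trans hm)
      (fun i hi => (hev i hi).trans (hρ i hi))
      ((hod (t + 1) (by omega) (by omega)).trans hB)
      ((hod (t + 2) (by omega) (by omega)).trans h1) (by omega)
    refine ⟨_, s', .while_true ?_ (.seq hr (.seq (.instr _ _) (.instr _ _))) hr', ?_, ?_, ?_, ?_, ?_⟩
    · simp only [Test.Holds]; omega
    · rw [Nat.succ_mul]; omega
    · rw [hc'.res, hacc, hd, Finset.sum_range_succ', add_zero]
      have : ∀ i, s.reg (2 * d) + 1 + i = s.reg (2 * d) + (i + 1) := by intro i; omega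
      simp only [this]
      omega
    · exact hc'.mem.trans hmem
    · exact fun i hi => (hc'.even i hi).trans (hev i hi)
    · exact fun j hj => (hc'.odd j hj).trans (hod j (by omega) (by omega))

theorem runs_compile (m : ℕ → ℕ) (x : Expr) : ∀ (d t : ℕ) (s : State), s.mem = m →
    ∃ T s', Runs (compile x d t) s T s' ∧ T ≤ cost (fun j => m (cell j)) x ∧
      Computed d t (eval m x d (vars s)) s s' := by
  induction x with
  | const k =>
    intro d t s hm
    refine ⟨1, _, .instr _ _, le_rfl, ?_, rfl, ?_, ?_⟩
    · simp [Instr.exec, eval]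
    · intro i _; simp only [Instr.exec, Function.update_apply]; rw [if_neg (by omega)]
    · intro i _; simp only [Instr.exec, Function.update_apply]; rw [if_neg (by omega)]
  | var i =>
    intro d t s hm
    by_cases hi : i < d
    · simp only [compile, eval, if_pos hi]
      refine ⟨1, _, .instr _ _, le_rfl, ?_, rfl, ?_, ?_⟩
      · simp [Instr.exec, vars]
      · intro i _; simp only [Instr.exec, Function.update_apply]; rw [if_neg (by omega)]
      · intro i _; simp only [Instr.exec, Function.update_apply]; rw [if_neg (by omega)]
    · simp only [compile, eval, if_neg hi]
      refine ⟨1, _, .instr _ _, le_rfl, ?_, rfl, ?_, ?_⟩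
      · simp [Instr.exec]
      · intro i _; simp only [Instr.exec, Function.update_apply]; rw [if_neg (by omega)]
      · intro i _; simp only [Instr.exec, Function.update_apply]; rw [if_neg (by omega)]
  | add x y hx hy =>
    intro d t s hm
    obtain ⟨T₁, s₁, r₁, b₁, c₁⟩ := hx d t s hm
    obtain ⟨T₂, s₂, r₂, b₂, c₂⟩ := hy d (t + 1) s₁ (c₁.mem.trans hm)
    -- The second operand is computed in the state left by the first, in which the first `d`
    -- variables are unchanged.
    rw [eval_congr m y d (vars s₁) (vars s) c₁.even] at c₂
    refine ⟨_, _, .seq r₁ (.seq r₂ (.instr _ _)), ?_, ?_, ?_, ?_, ?_⟩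
    · simp only [cost]; omega
    · simp only [Instr.exec, Function.update_self, eval]
      rw [c₂.res, c₂.odd t (by omega), c₁.res]
    · exact c₂.mem.trans c₁.mem
    · intro i hi
      simp only [Instr.exec, Function.update_apply]
      rw [if_neg (by omega), c₂.even i hi, c₁.even i hi]
    · intro i hi
      simp only [Instr.exec, Function.update_apply]
      rw [if_neg (by omega), c₂.odd i (by omega), c₁.odd i hi]
  | sub x y hx hy =>
    intro d t s hm
    obtain ⟨T₁, s₁, r₁, b₁, c₁⟩ := hx d t s hm
    obtain ⟨T₂, s₂, r₂, b₂, c₂⟩ := hy d (t + 1) s₁ (c₁.mem.trans hm)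
    rw [eval_congr m y d (vars s₁) (vars s) c₁.even] at c₂
    refine ⟨_, _, .seq r₁ (.seq r₂ (.instr _ _)), ?_, ?_, ?_, ?_, ?_⟩
    · simp only [cost]; omega
    · simp only [Instr.exec, Function.update_self, eval]
      rw [c₂.res, c₂.odd t (by omega), c₁.res]
    · exact c₂.mem.trans c₁.mem
    · intro i hi
      simp only [Instr.exec, Function.update_apply]
      rw [if_neg (by omega), c₂.even i hi, c₁.even i hi]
    · intro i hi
      simp only [Instr.exec, Function.update_apply]
      rw [if_neg (by omega), c₂.odd i (by omega), c₁.odd i hi]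
  | mem x hx =>
    intro d t s hm
    obtain ⟨T₁, s₁, r₁, b₁, c₁⟩ := hx d t s hm
    refine ⟨_, _, .seq r₁ (.instr _ _), ?_, ?_, ?_, ?_, ?_⟩
    · simp only [cost]; omega
    · simp only [Instr.exec, Function.update_self, eval]
      rw [c₁.res, c₁.mem, hm]
    · exact c₁.mem
    · intro i hi
      simp only [Instr.exec, Function.update_apply]
      rw [if_neg (by omega), c₁.even i hi]
    · intro i hi
      simp only [Instr.exec, Function.update_apply]
      rw [if_neg (by omega), c₁.odd i hi]
  | ite a b x y ha hb hx hy =>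
    intro d t s hm
    obtain ⟨T₁, s₁, r₁, b₁, c₁⟩ := ha d t s hm
    obtain ⟨T₂, s₂, r₂, b₂, c₂⟩ := hb d (t + 1) s₁ (c₁.mem.trans hm)
    rw [eval_congr m b d (vars s₁) (vars s) c₁.even] at c₂
    have hm₂ : s₂.mem = m := c₂.mem.trans (c₁.mem.trans hm)
    have hv : ∀ i < d, vars s₂ i = vars s i :=
      fun i hi => (c₂.even i hi).trans (c₁.even i hi)
    have ht : (Test.lt (2 * t + 1) (2 * (t + 1) + 1)).Holds s₂ ↔
        eval m a d (vars s) < eval m b d (vars s) := by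
      simp only [Test.Holds]
      rw [c₂.res, c₂.odd t (by omega), c₁.res]
    by_cases h : eval m a d (vars s) < eval m b d (vars s)
    · obtain ⟨T₃, s₃, r₃, b₃, c₃⟩ := hx d t s₂ hm₂
      rw [eval_congr m x d (vars s₂) (vars s) hv] at c₃
      refine ⟨_, _, .seq r₁ (.seq r₂ (.ite_true (ht.2 h) r₃)), ?_, ?_, ?_, ?_, ?_⟩
      · simp only [cost]; omega
      · simp only [eval, if_pos h]; exact c₃.res
      · exact c₃.mem.trans (c₂.mem.trans c₁.mem)
      · exact fun i hi => (c₃.even i hi).trans (hv i hi)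
      · exact fun i hi => (c₃.odd i hi).trans ((c₂.odd i (by omega)).trans (c₁.odd i hi))
    · obtain ⟨T₃, s₃, r₃, b₃, c₃⟩ := hy d t s₂ hm₂
      rw [eval_congr m y d (vars s₂) (vars s) hv] at c₃
      refine ⟨_, _, .seq r₁ (.seq r₂ (.ite_false (fun h' => h (ht.1 h')) r₃)), ?_, ?_, ?_, ?_, ?_⟩
      · simp only [cost]; omega
      · simp only [eval, if_neg h]; exact c₃.res
      · exact c₃.mem.trans (c₂.mem.trans c₁.mem)
      · exact fun i hi => (c₃.even i hi).trans (hv i hi)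
      · exact fun i hi => (c₃.odd i hi).trans ((c₂.odd i (by omega)).trans (c₁.odd i hi))
  | sum j x hx =>
    intro d t s hm
    set s₁ := (Instr.const (2 * t + 1) 0).exec s with hs₁
    set s₂ := (Instr.const (2 * (t + 1) + 1) (cell j)).exec s₁ with hs₂
    set s₃ := (Instr.load (2 * (t + 1) + 1) (2 * (t + 1) + 1)).exec s₂ with hs₃
    set s₄ := (Instr.const (2 * (t + 2) + 1) 1).exec s₃ with hs₄
    set s₅ := (Instr.const (2 * d) 0).exec s₄ with hs₅
    have hm₅ : s₅.mem = m := hm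
    have hev : ∀ i < d, s₅.reg (2 * i) = s.reg (2 * i) := by
      intro i hi
      simp only [hs₅, hs₄, hs₃, hs₂, hs₁, Instr.exec, Function.update_apply]
      rw [if_neg (by omega), if_neg (by omega), if_neg (by omega), if_neg (by omega),
        if_neg (by omega)]
    have hod : ∀ i < t, s₅.reg (2 * i + 1) = s.reg (2 * i + 1) := by
      intro i hi
      simp only [hs₅, hs₄, hs₃, hs₂, hs₁, Instr.exec, Function.update_apply]
      rw [if_neg (by omega), if_neg (by omega), if_neg (by omega), if_neg (by omega),
        if_neg (by omega)]
    have h0 : s₅.reg (2 * t + 1) = 0 := by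
      simp only [hs₅, hs₄, hs₃, hs₂, hs₁, Instr.exec, Function.update_apply]
      rw [if_neg (by omega), if_neg (by omega), if_neg (by omega), if_neg (by omega), if_pos trivial]
    have hB : s₅.reg (2 * (t + 1) + 1) = m (cell j) := by
      simp only [hs₅, hs₄, hs₃, hs₂, hs₁, Instr.exec, Function.update_apply]
      rw [if_neg (by omega), if_neg (by omega), if_pos trivial]
      simp only [if_true, hm]
    have h1 : s₅.reg (2 * (t + 2) + 1) = 1 := by
      simp only [hs₅, hs₄, hs₃, hs₂, hs₁, Instr.exec, Function.update_apply]
      rw [if_neg (by omega), if_pos trivial]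
    have hd : s₅.reg (2 * d) = 0 := by simp [hs₅, Instr.exec]
    obtain ⟨T, s', r, b, c⟩ := runs_sum_loop (body := compile x (d + 1) (t + 3)) (d := d) (t := t)
      (B := m (cell j)) (C := cost (fun j => m (cell j)) x) (m := m) (ρ := vars s)
      (g := fun i => eval m x (d + 1) (Function.update (vars s) d i))
      (by
        intro σ hσ hρ
        obtain ⟨T, s', r, b, c⟩ := hx (d + 1) (t + 3) σ hσ
        refine ⟨T, s', r, b, ?_⟩
        rw [eval_congr m x (d + 1) (vars σ) (Function.update (vars s) d (σ.reg (2 * d)))] at c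
        · exact c
        · intro i hi
          by_cases hid : i = d
          · subst hid; simp [vars]
          · rw [Function.update_of_ne hid]; exact hρ i (by omega))
      (m (cell j)) s₅ hm₅ hev hB h1 (by omega)
    refine ⟨_, s', .seq (.instr _ _) (.seq (.instr _ _) (.seq (.instr _ _) (.seq (.instr _ _)
      (.seq (.instr _ _) r)))), ?_, ?_, ?_, ?_, ?_⟩
    · simp only [cost]; omega
    · rw [c.res, h0, hd]; simp [eval]
    · exact c.mem
    · exact fun i hi => (c.even i hi).trans (hev i hi)
    · exact fun i hi => (c.odd i hi).trans (hod i hi)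
  | bind x y hx hy =>
    intro d t s hm
    obtain ⟨T₁, s₁, r₁, b₁, c₁⟩ := hx d t s hm
    set s₂ := (Instr.copy (2 * d) (2 * t + 1)).exec s₁ with hs₂
    obtain ⟨T₃, s₃, r₃, b₃, c₃⟩ := hy (d + 1) t s₂ (c₁.mem.trans hm)
    have hev : ∀ i < d, s₂.reg (2 * i) = s.reg (2 * i) := by
      intro i hi
      simp only [hs₂, Instr.exec, Function.update_apply]
      rw [if_neg (by omega), c₁.even i hi]
    rw [eval_congr m y (d + 1) (vars s₂) (Function.update (vars s) d (eval m x d (vars s)))] at c₃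
    · refine ⟨_, _, .seq r₁ (.seq (.instr _ _) r₃), ?_, c₃.res, c₃.mem.trans c₁.mem, ?_, ?_⟩
      · simp only [cost]; omega
      · exact fun i hi => (c₃.even i (by omega)).trans (hev i hi)
      · intro i hi
        rw [c₃.odd i hi]
        simp only [hs₂, Instr.exec, Function.update_apply]
        rw [if_neg (by omega), c₁.odd i hi]
    · intro i hi
      by_cases hid : i = d
      · subst hid
        simp only [vars, hs₂, Instr.exec, Function.update_self]
        exact c₁.res
      · rw [Function.update_of_ne hid]; exact hev i (by omega)

/-! ### The time bound from the nesting of sums -/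

/-- The exponent of the bound of the sums of kind `j` in the cost. -/
def deg (j : Bool) : Expr → ℕ
  | const _ => 0
  | var _ => 0
  | add x y => max (deg j x) (deg j y)
  | sub x y => max (deg j x) (deg j y)
  | mem x => deg j x
  | ite a b x y => max (max (deg j a) (deg j b)) (max (deg j x) (deg j y))
  | sum i x => deg j x + if i = j then 1 else 0
  | bind x y => max (deg j x) (deg j y)

/-- The constant factor in the cost. -/
def factor : Expr → ℕ
  | const _ => 1
  | var _ => 1
  | add x y => factor x + factor y + 1
  | sub x y => factor x + factor y + 1
  | mem x => factor x + 1
  | ite a b x y => factor a + factor b + factor x + factor y + 1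
  | sum _ x => factor x + 9
  | bind x y => factor x + factor y + 1

/-- Both bounds are at least one, so additive constants are absorbed by the monomial. A sum uses up
one factor `N j`; its three steps per round and six steps outside the rounds give the 9 in `factor`.
-/
theorem cost_le (N : Bool → ℕ) (hN : ∀ j, 1 ≤ N j) (x : Expr) :
    ∀ a b : ℕ, deg false x ≤ a → deg true x ≤ b →
      cost N x ≤ factor x * (N true ^ b * N false ^ a) := by
  have pos : ∀ a b : ℕ, 1 ≤ N true ^ b * N false ^ a := fun a b =>
    Nat.one_le_iff_ne_zero.2 (mul_ne_zero (pow_ne_zero _ (by have := hN true; omega))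
      (pow_ne_zero _ (by have := hN false; omega)))
  induction x with
  | const k => intro a b _ _; simpa [cost, factor] using pos a b
  | var i => intro a b _ _; simpa [cost, factor] using pos a b
  | add x y hx hy | sub x y hx hy | bind x y hx hy =>
    intro a b ha hb
    simp only [deg, max_le_iff] at ha hb
    have := hx a b ha.1 hb.1
    have := hy a b ha.2 hb.2
    have := pos a b
    simp only [cost, factor, add_mul]
    omega
  | mem x hx =>
    intro a b ha hb
    have := hx a b ha hb
    have := pos a b
    simp only [cost, factor, add_mul]
    omega
  | ite c d x y hc hd hx hy =>
    intro a b ha hb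
    simp only [deg, max_le_iff] at ha hb
    have := hc a b ha.1.1 hb.1.1
    have := hd a b ha.1.2 hb.1.2
    have := hx a b ha.2.1 hb.2.1
    have := hy a b ha.2.2 hb.2.2
    have := pos a b
    simp only [cost, factor, add_mul]
    omega
  | sum j x hx =>
    intro a b ha hb
    have key : ∃ a' b', deg false x ≤ a' ∧ deg true x ≤ b' ∧
        N j * (N true ^ b' * N false ^ a') = N true ^ b * N false ^ a := by
      cases j
      · simp only [deg, if_true, Bool.false_eq_true, if_false] at ha hb
        obtain ⟨a', rfl⟩ : ∃ a', a = a' + 1 := ⟨a - 1, by omega⟩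
        exact ⟨a', b, by omega, by omega, by ring⟩
      · simp only [deg, if_true, Bool.true_eq_false, if_false] at ha hb
        obtain ⟨b', rfl⟩ : ∃ b', b = b' + 1 := ⟨b - 1, by omega⟩
        exact ⟨a, b', by omega, by omega, by ring⟩
    obtain ⟨a', b', ha', hb', h⟩ := key
    have h1 := hx a' b' ha' hb'
    have h2 := pos a' b'
    have h3 := pos a b
    simp only [cost, factor]
    calc N j * (cost N x + 3) + 6
        ≤ N j * (factor x * (N true ^ b' * N false ^ a') + 3 * (N true ^ b' * N false ^ a')) + 6 := by
          gcongr; omega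
      _ = (factor x + 3) * (N j * (N true ^ b' * N false ^ a')) + 6 := by ring
      _ ≤ (factor x + 9) * (N true ^ b * N false ^ a) := by rw [h, add_mul, add_mul]; omega

/-- The program that decides whether the value of a closed expression is positive. -/
def decide (x : Expr) : Prog :=
  .seq (compile x 0 0) (.seq (.instr (.const 0 0)) (.ite (.lt 0 1) (.instr (.const 0 1)) .skip))

/-- The result sits in register 1, so register 0 is free for the answer. The three extra steps are
an assignment, a test and the chosen branch. -/
theorem answersWithin_decide (x : Expr) (input : List ℕ) (ρ : ℕ → ℕ) {a b : ℕ} {answer : Prop}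
    (h0 : 1 ≤ input.getD 0 0) (h1 : 1 ≤ input.getD 1 0)
    (ha : deg false x ≤ a) (hb : deg true x ≤ b)
    (h : answer ↔ 0 < eval (fun i => input.getD i 0) x 0 ρ) :
    AnswersWithin (decide x) input answer
      ((factor x + 3) * (input.getD 1 0 ^ b * input.getD 0 0 ^ a)) := by
  obtain ⟨T, s, r, hT, hc⟩ := runs_compile (fun i => input.getD i 0) x 0 0 (initial input) rfl
  rw [eval_congr _ x 0 _ ρ (by simp)] at hc
  have hcost := cost_le (fun j => input.getD (cell j) 0)
    (by intro j; cases j <;> simpa [cell]) x a b ha hb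
  simp only [cell, Bool.false_eq_true, if_false, if_true] at hcost
  have hpos : 1 ≤ input.getD 1 0 ^ b * input.getD 0 0 ^ a :=
    Nat.one_le_iff_ne_zero.2 (mul_ne_zero (pow_ne_zero _ (by omega)) (pow_ne_zero _ (by omega)))
  have hT' : T + 3 ≤ (factor x + 3) * (input.getD 1 0 ^ b * input.getD 0 0 ^ a) := by
    rw [add_mul]
    have : T ≤ _ := hT.trans hcost
    omega
  have hres := hc.res
  simp only [mul_zero, zero_add] at hres
  by_cases hv : 0 < eval (fun i => input.getD i 0) x 0 ρ
  · refine ⟨_, _, ?_, .seq r (.seq (.instr _ _) (.ite_true ?_ (.instr _ _))), .inl ⟨h.2 hv, ?_⟩⟩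
    · omega
    · simp only [Test.Holds, Instr.exec, Function.update_apply]
      rw [if_pos trivial, if_neg (by omega), hres]; exact hv
    · simp [Instr.exec]
  · refine ⟨_, _, ?_, .seq r (.seq (.instr _ _) (.ite_false ?_ (.skip _))),
      .inr ⟨fun h' => hv (h.1 h'), ?_⟩⟩
    · omega
    · simp only [Test.Holds, Instr.exec, Function.update_apply]
      rw [if_pos trivial, if_neg (by omega), hres]; exact hv
    · simp [Instr.exec]

end Expr
end RAM

/-! ### Stars with cut-off leaves and certificates -/

/-- A vertex-weighted, vertex-colored disjoint union of stars with possibly several centers: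
`s u` is the star of `u`, and every vertex outside `ctr` is a leaf that may be cut off. -/
structure StarSystem (n : ℕ) where
  w : Fin n → ℕ
  col : Fin n → ℕ
  s : Fin n → ℕ
  ctr : Finset (Fin n)
  c : ℕ
  p : ℕ
  m : ℕ

namespace StarSystem

open Finset

variable {n : ℕ} (D : StarSystem n)

/-- Colors are below `c`, stars are below `m ≤ 2`, and every star has a center. -/
structure WellFormed : Prop where
  col_lt : ∀ u, D.col u < D.c
  p_lt : D.p < D.c
  s_lt : ∀ u, D.s u < D.m
  m_le : D.m ≤ 2
  exists_center : ∀ i < D.m, ∃ u ∈ D.ctr, D.s u = i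

/-- Leaves are ordered by weight, ties being broken by the numbering; centers come last. -/
def lt (u v : Fin n) : Prop := v ∈ D.ctr ∨ D.w u < D.w v ∨ (D.w u = D.w v ∧ u < v)

instance (u v : Fin n) : Decidable (D.lt u v) := by unfold lt; infer_instance

/-- The weight of color `r` in star `i` after the vertices of `S` have been cut off. -/
def kept (S : Finset (Fin n)) (i r : ℕ) : ℕ :=
  ∑ u with u ∉ S ∧ D.s u = i ∧ D.col u = r, D.w u

/-- The weight of color `r` at the centers of star `i`. -/
def base (i r : ℕ) : ℕ := ∑ u with u ∈ D.ctr ∧ D.s u = i ∧ D.col u = r, D.w u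

/-- The leaves of positive weight and color `r` in star `i`. -/
def leaves (i r : ℕ) : Finset (Fin n) := {u | u ∉ D.ctr ∧ D.w u ≠ 0 ∧ D.s u = i ∧ D.col u = r}

/-- The leaves of weight zero. -/
def zeros : Finset (Fin n) := {u | u ∉ D.ctr ∧ D.w u = 0}

/-- The weight of the centers and of the leaves up to `u`, of the same star and color as `u`. -/
def upto (u : Fin n) : ℕ :=
  ∑ u' with D.s u' = D.s u ∧ D.col u' = D.col u ∧ (u' ∈ D.ctr ∨ ¬ D.lt u u'), D.w u'

/-- The weight of the centers and of the leaves from `v` on in star `i`, of the color of `v`. -/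
def threshold (i : ℕ) (v : Fin n) : ℕ :=
  ∑ u with D.s u = i ∧ D.col u = D.col v ∧ (u ∈ D.ctr ∨ ¬ D.lt u v), D.w u

/-- After cutting off `S`, color `r` has maximum weight in star `i`. -/
def IsCol (S : Finset (Fin n)) (i r : ℕ) : Prop := ∀ r' < D.c, D.kept S i r' ≤ D.kept S i r

/-- After cutting off `S`, color `p` is the unique color of maximum weight in star `i`. -/
def IsUniq (S : Finset (Fin n)) (i : ℕ) : Prop :=
  ∀ r < D.c, r ≠ D.p → D.kept S i r < D.kept S i D.p

open Classical in
/-- Cutting off the leaves in `S` makes `p` win, where a leaf of weight zero counts for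
each color but `p`. -/
def Balanced (S : Finset (Fin n)) : Prop :=
  ∀ r < D.c, r ≠ D.p →
    #{u ∈ S | D.w u ≠ 0 ∧ D.col u = r} + #{u ∈ S | D.w u = 0} +
        #{i ∈ range D.m | D.IsCol S i r} <
      #{u ∈ S | D.w u ≠ 0 ∧ D.col u = D.p} + #{i ∈ range D.m | D.IsUniq S i}

section Certificate

variable (v : ℕ → Fin n)

/-- The guessed maximum weight of a color in star `i`. -/
def top (i : ℕ) : ℕ := if i < D.m then D.threshold i (v i) else 1

/-- The guessed color of maximum weight in star `i`; it is `c` if all weights vanish. -/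
def winner (i : ℕ) : ℕ := if i < D.m ∧ D.threshold i (v i) ≠ 0 then D.col (v i) else D.c

/-- The number one if `p` is the guessed winner in star `i`, otherwise zero. -/
def pwin (i : ℕ) : ℕ := if D.winner v i = D.p then 1 else 0

/-- The leaves of color `r` to be cut off in any case. -/
def lo (r : ℕ) : Finset (Fin n) :=
  {u | u ∉ D.ctr ∧ D.w u ≠ 0 ∧ D.col u = r ∧
    if r = D.winner v (D.s u) then D.lt u (v (D.s u))
    else D.top v (D.s u) < D.upto u + D.pwin v (D.s u)}

/-- The leaves of color `r` to be cut off if ties are to be avoided. -/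
def mid (r : ℕ) : Finset (Fin n) :=
  {u | u ∉ D.ctr ∧ D.w u ≠ 0 ∧ D.col u = r ∧
    if r = D.winner v (D.s u) then D.lt u (v (D.s u)) else D.top v (D.s u) ≤ D.upto u}

/-- The leaves of color `r` that may be cut off. -/
def hi (r : ℕ) : Finset (Fin n) :=
  {u | u ∉ D.ctr ∧ D.w u ≠ 0 ∧ D.col u = r ∧
    (r = D.winner v (D.s u) → D.lt u (v (D.s u)))}

/-- The number of stars in which color `r ≠ p` is inevitably of maximum weight. -/
def ties (r : ℕ) : ℕ :=
  ∑ i ∈ range 2, if r = D.winner v i ∨ D.top v i ≤ D.base i r then 1 else 0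

/-- The condition checked by the algorithm: `v` determines the winners, `d + 1 + z` is the number
of parts won by `p`, and `z` leaves of weight zero are cut off. -/
structure IsCertificate (k d z : ℕ) : Prop where
  base_le : ∀ r < D.c, ∀ i < 2, r ≠ D.winner v i → D.base i r + D.pwin v i ≤ D.top v i
  mid_le : ∀ r < D.c, r ≠ D.p → #(D.mid v r) + D.ties v r ≤ d
  z_le : z ≤ #D.zeros
  lo_le : #(D.lo v D.p) + (D.pwin v 0 + D.pwin v 1) ≤ d + 1 + z
  le_hi : d + 1 + z ≤ #(D.hi v D.p) + (D.pwin v 0 + D.pwin v 1)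
  sum_le : ∑ r ∈ range D.c with r ≠ D.p, #(D.lo v r) + (d + 1 + z) + z + D.m ≤
    k + (D.pwin v 0 + D.pwin v 1)
  le_sum : k + (D.pwin v 0 + D.pwin v 1) ≤
    ∑ r ∈ range D.c with r ≠ D.p, min #(D.hi v r) (d - D.ties v r) + (d + 1 + z) + z + D.m

end Certificate

/-! ### Exchange arguments in a single star and color -/

variable {D}

theorem lt_iff {u v : Fin n} (hv : v ∉ D.ctr) :
    D.lt u v ↔ toLex (D.w u, u) < toLex (D.w v, v) := by
  rw [Prod.Lex.toLex_lt_toLex]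
  simp [lt, hv]

theorem mem_leaves {i r : ℕ} {u : Fin n} :
    u ∈ D.leaves i r ↔ u ∉ D.ctr ∧ D.w u ≠ 0 ∧ D.s u = i ∧ D.col u = r := by
  simp [leaves]

theorem kept_eq {S : Finset (Fin n)} (hS : Disjoint S D.ctr) (i r : ℕ) :
    D.kept S i r = D.base i r + ∑ u ∈ D.leaves i r with u ∉ S, D.w u := by
  rw [kept, base, leaves, filter_filter, sum_filter, sum_filter, sum_filter, ← sum_add_distrib]
  refine sum_congr rfl fun u _ => ?_
  have : u ∈ D.ctr → u ∉ S := fun h h' => disjoint_left.1 hS h' h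
  by_cases h1 : u ∈ D.ctr <;> by_cases h2 : D.w u = 0 <;> by_cases h3 : u ∈ S <;> simp_all

theorem upto_eq {i r : ℕ} {u : Fin n} (hu : u ∈ D.leaves i r) :
    D.upto u = D.base i r + ∑ u' ∈ D.leaves i r with ¬ D.lt u u', D.w u' := by
  obtain ⟨_, _, rfl, rfl⟩ := mem_leaves.1 hu
  rw [upto, base, leaves, filter_filter, sum_filter, sum_filter, sum_filter, ← sum_add_distrib]
  refine sum_congr rfl fun u' _ => ?_
  by_cases h1 : u' ∈ D.ctr <;> by_cases h2 : D.w u' = 0 <;> simp [h1, h2, and_assoc]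

theorem threshold_eq (i : ℕ) (v : Fin n) :
    D.threshold i v =
      D.base i (D.col v) + ∑ u ∈ D.leaves i (D.col v) with ¬ D.lt u v, D.w u := by
  rw [threshold, base, leaves, filter_filter, sum_filter, sum_filter, sum_filter,
    ← sum_add_distrib]
  refine sum_congr rfl fun u' _ => ?_
  by_cases h1 : u' ∈ D.ctr <;> by_cases h2 : D.w u' = 0 <;> simp [h1, h2, and_assoc]

/-- Among the subsets of a given size, initial segments have minimum weight. -/
theorem sum_le_sum_of_lower {α : Type*} [DecidableEq α] {f : α → ℕ} {I K : Finset α}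
    (h : ∀ x ∈ I, ∀ y ∈ K, y ∉ I → f x ≤ f y) (hc : #I ≤ #K) : ∑ x ∈ I, f x ≤ ∑ x ∈ K, f x := by
  have h1 := card_inter_add_card_sdiff I K
  have h2 := card_inter_add_card_sdiff K I
  rw [inter_comm] at h2
  -- The largest value of `f` on `I \ K` separates the values on `I \ K` from those on `K \ I`.
  have h3 : ∑ x ∈ I \ K, f x ≤ #(I \ K) * (I \ K).sup f := by
    simpa using sum_le_card_nsmul (I \ K) f _ fun x hx => le_sup (f := f) hx
  have h4 : #(K \ I) * (I \ K).sup f ≤ ∑ x ∈ K \ I, f x := by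
    simpa using card_nsmul_le_sum (K \ I) f _ fun y hy => Finset.sup_le fun x hx =>
      h x (mem_sdiff.1 hx).1 y (mem_sdiff.1 hy).1 (mem_sdiff.1 hy).2
  have h5 : #(I \ K) * (I \ K).sup f ≤ #(K \ I) * (I \ K).sup f :=
    Nat.mul_le_mul_right _ (by omega)
  have h6 := sum_inter_add_sum_sdiff I K f
  have h7 := sum_inter_add_sum_sdiff K I f
  rw [inter_comm] at h7
  omega

theorem exists_greatest {F : Finset (Fin n)} (hF : ∀ u ∈ F, u ∉ D.ctr) (hne : F.Nonempty) :
    ∃ v ∈ F, ∀ u ∈ F, ¬ D.lt v u := by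
  obtain ⟨v, hv, h⟩ := exists_max_image F (fun u => toLex (D.w u, u)) hne
  exact ⟨v, hv, fun u hu => by rw [lt_iff (hF u hu)]; exact not_lt.2 (h u hu)⟩

theorem exists_least {F : Finset (Fin n)} (hF : ∀ u ∈ F, u ∉ D.ctr) (hne : F.Nonempty) :
    ∃ v ∈ F, ∀ u ∈ F, ¬ D.lt u v := by
  obtain ⟨v, hv, h⟩ := exists_min_image F (fun u => toLex (D.w u, u)) hne
  exact ⟨v, hv, fun u hu => by rw [lt_iff (hF v hv)]; exact not_lt.2 (h u hu)⟩

/-- The rank is strictly monotone, hence injective into `range #F`, hence onto by counting. -/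
theorem exists_rank {F : Finset (Fin n)} (hF : ∀ u ∈ F, u ∉ D.ctr) {x : ℕ} (hx : x < #F) :
    ∃ v ∈ F, #{u ∈ F | D.lt u v} = x := by
  have hmaps : Set.MapsTo (fun v => #{u ∈ F | D.lt u v}) F (range #F) := by
    intro v hv
    simp only [coe_range, Set.mem_Iio]
    refine card_lt_card (filter_ssubset.2 ⟨v, hv, ?_⟩)
    rw [lt_iff (hF v hv)]; exact lt_irrefl _
  have mono : ∀ u ∈ F, ∀ v ∈ F, toLex (D.w u, u) < toLex (D.w v, v) →
      #{x ∈ F | D.lt x u} < #{x ∈ F | D.lt x v} := by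
    intro u hu v hv huv
    refine card_lt_card ⟨fun x hx => ?_, fun h => ?_⟩
    · rw [mem_filter, lt_iff (hF u hu)] at hx
      rw [mem_filter, lt_iff (hF v hv)]
      exact ⟨hx.1, hx.2.trans huv⟩
    · have : u ∈ ({x ∈ F | D.lt x v} : Finset _) := mem_filter.2 ⟨hu, (lt_iff (hF v hv)).2 huv⟩
      have := (mem_filter.1 (h this)).2
      rw [lt_iff (hF u hu)] at this
      exact lt_irrefl _ this
  have hinj : Set.InjOn (fun v => #{u ∈ F | D.lt u v}) F := by
    intro u hu v hv huv
    rcases lt_trichotomy (toLex (D.w u, u)) (toLex (D.w v, v)) with h | h | h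
    · exact absurd huv (mono u hu v hv h).ne
    · exact congrArg Prod.snd (toLex.injective h)
    · exact absurd huv (mono v hv u hu h).ne'
  obtain ⟨v, hv, h⟩ := surjOn_of_injOn_of_card_le _ hmaps hinj (by simp) (mem_coe.2 (mem_range.2 hx))
  exact ⟨v, hv, h⟩

/-- If the weight `N` is not reached by keeping the leaves outside of `S`, then `S` has at least as
many leaves as it takes to cut off the heaviest ones. -/
theorem card_le_of_kept_lt {S : Finset (Fin n)} {i r N : ℕ}
    (h : D.base i r + ∑ u ∈ D.leaves i r with u ∉ S, D.w u < N) :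
    #{u ∈ D.leaves i r | N ≤ D.upto u} ≤ #{u ∈ D.leaves i r | u ∈ S} := by
  by_contra! hlt
  have hc : ∀ u ∈ D.leaves i r, u ∉ D.ctr := fun u hu => (mem_leaves.1 hu).1
  -- Let `t` be the least leaf whose initial segment reaches weight `N`. If `S` were too small, at
  -- least as many leaves would be kept as there are up to `t`, and these weigh no less than that
  -- segment.
  obtain ⟨t, ht, hmin⟩ := exists_least (D := D) (F := {u ∈ D.leaves i r | N ≤ D.upto u})
    (fun u hu => hc u (mem_filter.1 hu).1) (card_pos.1 (by omega))
  rw [mem_filter] at ht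
  have hsub : ({u ∈ D.leaves i r | ¬ D.lt t u} : Finset _) ⊆
      insert t ({u ∈ D.leaves i r | ¬ N ≤ D.upto u} : Finset _) := by
    intro u hu
    rw [mem_filter] at hu
    rw [mem_insert, mem_filter]
    by_cases h' : N ≤ D.upto u
    · left
      have h1 := hmin u (mem_filter.2 ⟨hu.1, h'⟩)
      have h2 := hu.2
      rw [lt_iff (hc t ht.1), not_lt] at h1
      rw [lt_iff (hc u hu.1), not_lt] at h2
      exact congrArg Prod.snd (toLex.injective (le_antisymm h2 h1))
    · exact .inr ⟨hu.1, h'⟩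
  have h1 := (card_le_card hsub).trans (card_insert_le _ _)
  have h2 := card_filter_add_card_filter_not (s := D.leaves i r) (fun u => N ≤ D.upto u)
  have h3 := card_filter_add_card_filter_not (s := D.leaves i r) (fun u => u ∈ S)
  have h4 : ∑ u ∈ D.leaves i r with ¬ D.lt t u, D.w u ≤ ∑ u ∈ D.leaves i r with u ∉ S, D.w u := by
    refine sum_le_sum_of_lower (fun x hx y hy hxy => ?_) (by omega)
    rw [mem_filter] at hx hy
    have hy' : D.lt t y := by
      by_contra hty
      exact hxy (mem_filter.2 ⟨hy.1, hty⟩)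
    have hx' := hx.2
    have := hc y hy.1
    have := hc x hx.1
    simp only [lt, *, false_or] at hx' hy'
    omega
  have h5 := upto_eq ht.1
  omega

/-- All kept leaves lie in the initial segment ending at the greatest kept leaf `t`, so the kept
weight is at most `upto t`. If no leaf is kept, only the base remains. -/
theorem kept_lt {S : Finset (Fin n)} (hS : Disjoint S D.ctr) {i r N : ℕ} (hb : D.base i r < N)
    (h : ∀ u ∈ D.leaves i r, u ∉ S → D.upto u < N) : D.kept S i r < N := by
  rw [kept_eq hS]
  rcases ({u ∈ D.leaves i r | u ∉ S} : Finset _).eq_empty_or_nonempty with he | hne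
  · rw [he]; simpa using hb
  · obtain ⟨t, ht, hmax⟩ := exists_greatest (D := D)
      (fun u hu => (mem_leaves.1 (mem_filter.1 hu).1).1) hne
    have ht' := mem_filter.1 ht
    have := h t ht'.1 ht'.2
    rw [upto_eq ht'.1] at this
    refine lt_of_le_of_lt (Nat.add_le_add_left (sum_le_sum_of_subset fun u hu => ?_) _) this
    exact mem_filter.2 ⟨(mem_filter.1 hu).1, hmax u hu⟩

end StarSystem

/-! ### From a certificate to a set of cut-off leaves -/

namespace StarSystem

open Finset
variable {n : ℕ} {D : StarSystem n} {v : ℕ → Fin n}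

theorem mem_lo {r : ℕ} {u : Fin n} : u ∈ D.lo v r ↔ u ∉ D.ctr ∧ D.w u ≠ 0 ∧ D.col u = r ∧
    if r = D.winner v (D.s u) then D.lt u (v (D.s u))
    else D.top v (D.s u) < D.upto u + D.pwin v (D.s u) := by simp [lo]

theorem mem_mid {r : ℕ} {u : Fin n} : u ∈ D.mid v r ↔ u ∉ D.ctr ∧ D.w u ≠ 0 ∧ D.col u = r ∧
    if r = D.winner v (D.s u) then D.lt u (v (D.s u)) else D.top v (D.s u) ≤ D.upto u := by
  simp [mid]

theorem mem_hi {r : ℕ} {u : Fin n} : u ∈ D.hi v r ↔ u ∉ D.ctr ∧ D.w u ≠ 0 ∧ D.col u = r ∧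
    (r = D.winner v (D.s u) → D.lt u (v (D.s u))) := by simp [hi]

theorem pwin_le (i : ℕ) : D.pwin v i ≤ 1 := by unfold pwin; split_ifs <;> omega

theorem lo_subset_mid (r : ℕ) : D.lo v r ⊆ D.mid v r := by
  intro u hu
  rw [mem_lo] at hu
  rw [mem_mid]
  refine ⟨hu.1, hu.2.1, hu.2.2.1, ?_⟩
  have h := hu.2.2.2
  split_ifs at h ⊢ with hr
  · exact h
  · have := pwin_le (D := D) (v := v) (D.s u)
    omega

theorem mid_subset_hi (r : ℕ) : D.mid v r ⊆ D.hi v r := by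
  intro u hu
  rw [mem_mid] at hu
  rw [mem_hi]
  refine ⟨hu.1, hu.2.1, hu.2.2.1, fun hr => ?_⟩
  have h := hu.2.2.2
  rwa [if_pos hr] at h

/-- Cutting off `S` respects the bounds given by `v`. -/
structure Respects (D : StarSystem n) (v : ℕ → Fin n) (S : Finset (Fin n)) : Prop where
  disj : Disjoint S D.ctr
  lo_sub : ∀ r < D.c, D.lo v r ⊆ S
  sub_hi : ∀ u ∈ S, D.w u ≠ 0 → u ∈ D.hi v (D.col u)
  base_le : ∀ r < D.c, ∀ i < 2, r ≠ D.winner v i → D.base i r + D.pwin v i ≤ D.top v i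

namespace Respects

variable {S : Finset (Fin n)} (h : D.Respects v S) (hD : D.WellFormed)
include h

theorem kept_add_le {r i : ℕ} (hr : r < D.c) (hi : i < 2) (hw : r ≠ D.winner v i) :
    D.kept S i r + D.pwin v i ≤ D.top v i := by
  have hb := h.base_le r hr i hi hw
  -- This `N` turns the bound `top`, lowered by one if `p` is to win alone, into a strict one; the
  -- leaves reaching it are exactly those of `lo`.
  have := kept_lt h.disj (i := i) (r := r) (N := D.top v i + 1 - D.pwin v i) (by omega) ?_
  · omega
  · intro u hu huS
    by_contra hcon
    obtain ⟨h1, h2, rfl, rfl⟩ := mem_leaves.1 hu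
    refine huS (h.lo_sub _ hr (mem_lo.2 ⟨h1, h2, rfl, ?_⟩))
    rw [if_neg hw]
    omega

include hD

/-- In star `i` and the winning color, `lo` and `hi` both consist of the leaves before `v i`, so the
cut is forced. -/
theorem kept_winner {i : ℕ} (hi : i < D.m) (hw : D.winner v i ≠ D.c) :
    D.kept S i (D.winner v i) = D.top v i := by
  have hcond : D.threshold i (v i) ≠ 0 := by
    intro h0; exact hw (by simp [winner, h0])
  have hwin : D.winner v i = D.col (v i) := by simp [winner, hi, hcond]
  rw [top, if_pos hi, threshold_eq, kept_eq h.disj, hwin]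
  congr 2
  ext u
  simp only [mem_filter, and_congr_right_iff]
  intro hu
  obtain ⟨h1, h2, rfl, h4⟩ := mem_leaves.1 hu
  rw [not_iff_not]
  constructor
  · intro huS
    exact (mem_hi.1 (h.sub_hi u huS h2)).2.2.2 (by rw [hwin, h4])
  · intro hlt
    refine h.lo_sub _ (hD.col_lt u) (mem_lo.2 ⟨h1, h2, rfl, ?_⟩)
    rwa [if_pos (by rw [hwin, h4])]

theorem isUniq {i : ℕ} (hi : i < D.m) (hw : D.winner v i = D.p) : D.IsUniq S i := by
  intro r hr hrp
  have hm := hD.m_le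
  have h1 := h.kept_add_le hr (by omega : i < 2) (by rw [hw]; exact hrp)
  have h2 := h.kept_winner hD hi (by rw [hw]; exact hD.p_lt.ne)
  rw [hw] at h2
  rw [h2]
  simp only [pwin, hw, if_true] at h1
  omega

/-- An inequality suffices, since further stars won by `p` only help. An absent star has the dummy
winner `c`, which is not `p`. -/
theorem pwin_add_pwin_le [DecidablePred (D.IsUniq S)] :
    D.pwin v 0 + D.pwin v 1 ≤ #{i ∈ range D.m | D.IsUniq S i} := by
  have key : ({i ∈ range 2 | D.winner v i = D.p} : Finset ℕ) ⊆
      {i ∈ range D.m | D.IsUniq S i} := by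
    intro i hi
    rw [mem_filter] at hi
    have him : i < D.m := by
      by_contra hcon
      have := hi.2
      rw [winner, if_neg (by tauto)] at this
      exact hD.p_lt.ne' this
    exact mem_filter.2 ⟨mem_range.2 him, h.isUniq hD him hi.2⟩
  refine le_trans (le_of_eq ?_) (card_le_card key)
  rw [card_filter, sum_range_succ, sum_range_one]
  rfl

/-- A star won by `r` that `ties` does not count contains an uncut leaf of `mid`; otherwise
`kept_lt` would push `r` below `top`. Each such star is charged to such a leaf. -/
theorem card_isCol_le (r : ℕ) [DecidablePred (D.IsCol S · r)] :
    #{i ∈ range D.m | D.IsCol S i r} ≤ D.ties v r + #(D.mid v r \ S) := by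
  have hm := hD.m_le
  have key : ({i ∈ range D.m | D.IsCol S i r} : Finset ℕ) ⊆
      ({i ∈ range 2 | r = D.winner v i ∨ D.top v i ≤ D.base i r} : Finset ℕ) ∪
        (D.mid v r \ S).image D.s := by
    intro i hi
    rw [mem_filter, mem_range] at hi
    rw [mem_union, mem_filter, mem_range]
    by_cases hcase : r = D.winner v i ∨ D.top v i ≤ D.base i r
    · exact .inl ⟨by omega, hcase⟩
    right
    rw [not_or, not_le] at hcase
    have hle : D.top v i ≤ D.kept S i r := by
      by_cases hw : D.winner v i = D.c
      -- For an existing star, the dummy winner `c` signals that the guessed weight is zero.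
      · have : D.top v i = 0 := by
          rw [top, if_pos hi.1]
          by_contra h0
          rw [winner, if_pos ⟨hi.1, h0⟩] at hw
          exact (hD.col_lt _).ne hw
        omega
      · rw [← h.kept_winner hD hi.1 hw]
        refine hi.2 _ ?_
        rw [winner] at hw ⊢
        split_ifs at hw ⊢ with hc
        · exact hD.col_lt _
        · exact absurd rfl hw
    by_contra hcon
    refine absurd hle (not_le.2 (kept_lt h.disj hcase.2 fun u hu huS => ?_))
    obtain ⟨h1, h2, rfl, h4⟩ := mem_leaves.1 hu
    by_contra hlt
    refine hcon (mem_image.2 ⟨u, mem_sdiff.2 ⟨mem_mid.2 ⟨h1, h2, h4, ?_⟩, huS⟩, rfl⟩)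
    rw [if_neg hcase.1]
    omega
  refine (card_le_card key).trans ((card_union_le _ _).trans ?_)
  refine Nat.add_le_add (le_of_eq ?_) card_image_le
  rw [card_filter, ties]

end Respects

/-- Each color `r ≠ p` gets a reservoir `U r` between `mid` and `hi`. However the cut leaves are
chosen between `lo` and `U r`, the cut leaves and the uncut leaves of `mid` together fit into `U r`,
so `r` gets at most `#(U r) + ties ≤ d` parts. This freedom allows the total number of cuts to be
prescribed. -/
theorem IsCertificate.exists_balanced (hD : D.WellFormed) {k d z : ℕ}
    (h : D.IsCertificate v k d z) :
    ∃ S, Disjoint S D.ctr ∧ #S + D.m = k ∧ D.Balanced S := by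
  classical
  have hup : ∀ r, ∃ U, r < D.c → r ≠ D.p →
      D.mid v r ⊆ U ∧ U ⊆ D.hi v r ∧ #U = min #(D.hi v r) (d - D.ties v r) := by
    intro r
    by_cases hr : r < D.c ∧ r ≠ D.p
    · have h1 := h.mid_le r hr.1 hr.2
      have h2 := card_le_card (mid_subset_hi (D := D) (v := v) r)
      obtain ⟨U, hU⟩ := exists_subsuperset_card_eq (mid_subset_hi (D := D) (v := v) r)
        (n := min #(D.hi v r) (d - D.ties v r)) (by omega) (by omega)
      exact ⟨U, fun _ _ => hU⟩
    · exact ⟨∅, fun h1 h2 => absurd ⟨h1, h2⟩ hr⟩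
  choose U hU using hup
  set R : Finset ℕ := {r ∈ range D.c | r ≠ D.p} with hR
  have memR : ∀ r, r ∈ R ↔ r < D.c ∧ r ≠ D.p := by simp [hR]
  have hcolU : ∀ r ∈ R, ∀ u ∈ U r, u ∉ D.ctr ∧ D.w u ≠ 0 ∧ D.col u = r := by
    intro r hr u hu
    have := mem_hi.1 ((hU r ((memR r).1 hr).1 ((memR r).1 hr).2).2.1 hu)
    exact ⟨this.1, this.2.1, this.2.2.1⟩
  have cardLo : #(R.biUnion (D.lo v)) = ∑ r ∈ R, #(D.lo v r) := by
    refine card_biUnion fun r _ r' _ hrr => disjoint_left.2 fun u hu hu' => hrr ?_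
    exact (mem_lo.1 hu).2.2.1.symm.trans (mem_lo.1 hu').2.2.1
  have cardU : #(R.biUnion U) = ∑ r ∈ R, min #(D.hi v r) (d - D.ties v r) := by
    rw [card_biUnion fun r hr r' hr' hrr => disjoint_left.2 fun u hu hu' => hrr
      ((hcolU r hr u hu).2.2.symm.trans (hcolU r' hr' u hu').2.2)]
    exact sum_congr rfl fun r hr => (hU r ((memR r).1 hr).1 ((memR r).1 hr).2).2.2
  have hsum_le := h.sum_le
  have hle_sum := h.le_sum
  have hlo_le := h.lo_le
  have hle_hi := h.le_hi
  rw [← hR] at hsum_le hle_sum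
  -- The leaves of colors other than `p` make up what is left of `k` after the `m` stars, the `z`
  -- leaves of weight zero and the leaves of color `p` in `S₂`.
  obtain ⟨S₁, hS₁lo, hS₁U, hS₁c⟩ := exists_subsuperset_card_eq
    (s := R.biUnion (D.lo v)) (t := R.biUnion U)
    (n := k + (D.pwin v 0 + D.pwin v 1) - (d + 1 + z) - z - D.m)
    (biUnion_mono fun r hr => (lo_subset_mid r).trans
      (hU r ((memR r).1 hr).1 ((memR r).1 hr).2).1) (by omega) (by omega)
  obtain ⟨S₂, hS₂lo, hS₂hi, hS₂c⟩ := exists_subsuperset_card_eq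
    ((lo_subset_mid (D := D) (v := v) D.p).trans (mid_subset_hi D.p))
    (n := d + 1 + z - (D.pwin v 0 + D.pwin v 1)) (by omega) (by omega)
  obtain ⟨S₃, hS₃, hS₃c⟩ := exists_subset_card_eq h.z_le
  have mem₁ : ∀ u ∈ S₁, u ∉ D.ctr ∧ D.w u ≠ 0 ∧ D.col u ≠ D.p ∧ u ∈ U (D.col u) := by
    intro u hu
    obtain ⟨r, hr, hur⟩ := mem_biUnion.1 (hS₁U hu)
    obtain ⟨h1, h2, rfl⟩ := hcolU r hr u hur
    exact ⟨h1, h2, ((memR _).1 hr).2, hur⟩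
  have mem₂ : ∀ u ∈ S₂, u ∉ D.ctr ∧ D.w u ≠ 0 ∧ D.col u = D.p := by
    intro u hu
    have := mem_hi.1 (hS₂hi hu)
    exact ⟨this.1, this.2.1, this.2.2.1⟩
  have mem₃ : ∀ u ∈ S₃, u ∉ D.ctr ∧ D.w u = 0 := by
    intro u hu
    simpa [zeros] using hS₃ hu
  have d12 : Disjoint S₁ S₂ := disjoint_left.2 fun u h1 h2 => (mem₁ u h1).2.2.1 (mem₂ u h2).2.2
  have d123 : Disjoint (S₁ ∪ S₂) S₃ := disjoint_left.2 fun u h1 h2 => by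
    rcases mem_union.1 h1 with h1 | h1
    · exact (mem₁ u h1).2.1 (mem₃ u h2).2
    · exact (mem₂ u h1).2.1 (mem₃ u h2).2
  set S := S₁ ∪ S₂ ∪ S₃ with hS
  have memS : ∀ u, u ∈ S ↔ u ∈ S₁ ∨ u ∈ S₂ ∨ u ∈ S₃ := by simp [hS]
  have resp : D.Respects v S := by
    refine ⟨disjoint_left.2 fun u hu => ?_, fun r hr u hu => ?_, fun u hu hw => ?_, h.base_le⟩
    · rcases (memS u).1 hu with hu | hu | hu
      · exact (mem₁ u hu).1
      · exact (mem₂ u hu).1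
      · exact (mem₃ u hu).1
    · rw [memS]
      by_cases hrp : r = D.p
      · subst hrp; exact .inr (.inl (hS₂lo hu))
      · exact .inl (hS₁lo (mem_biUnion.2 ⟨r, (memR r).2 ⟨hr, hrp⟩, hu⟩))
    · rcases (memS u).1 hu with hu | hu | hu
      · have := mem₁ u hu
        exact (hU _ (hD.col_lt u) this.2.2.1).2.1 this.2.2.2
      · rw [(mem₂ u hu).2.2]; exact hS₂hi hu
      · exact absurd (mem₃ u hu).2 hw
  refine ⟨S, resp.disj, ?_, fun r hr hrp => ?_⟩
  · rw [hS, card_union_of_disjoint d123, card_union_of_disjoint d12]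
    omega
  · have e3 : ({u ∈ S | D.w u = 0} : Finset _) = S₃ := by
      ext u
      rw [mem_filter, memS]
      constructor
      · rintro ⟨hu | hu | hu, hw⟩
        · exact absurd hw (mem₁ u hu).2.1
        · exact absurd hw (mem₂ u hu).2.1
        · exact hu
      · exact fun hu => ⟨.inr (.inr hu), (mem₃ u hu).2⟩
    have e2 : ({u ∈ S | D.w u ≠ 0 ∧ D.col u = D.p} : Finset _) = S₂ := by
      ext u
      rw [mem_filter, memS]
      constructor
      · rintro ⟨hu | hu | hu, hw, hc⟩
        · exact absurd hc (mem₁ u hu).2.2.1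
        · exact hu
        · exact absurd (mem₃ u hu).2 hw
      · exact fun hu => ⟨.inr (.inl hu), (mem₂ u hu).2⟩
    -- Cut leaves and avoidable ties are counted together inside `U r`.
    have hsub : ({u ∈ S | D.w u ≠ 0 ∧ D.col u = r} : Finset _) ∪ (D.mid v r \ S) ⊆ U r := by
      intro u hu
      rcases mem_union.1 hu with hu | hu
      · obtain ⟨huS, hw, rfl⟩ := mem_filter.1 hu
        rcases (memS u).1 huS with hu | hu | hu
        · exact (mem₁ u hu).2.2.2
        · exact absurd (mem₂ u hu).2.2 hrp
        · exact absurd (mem₃ u hu).2 hw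
      · exact (hU r hr hrp).1 (mem_sdiff.1 hu).1
    have h1 := card_le_card hsub
    rw [card_union_of_disjoint (disjoint_left.2 fun u hu hu' =>
      (mem_sdiff.1 hu').2 (mem_filter.1 hu).1), (hU r hr hrp).2.2] at h1
    have h2 := resp.card_isCol_le hD r
    have h3 := resp.pwin_add_pwin_le hD
    have h4 := h.mid_le r hr hrp
    rw [e3, e2]
    omega

end StarSystem

/-! ### From a set of cut-off leaves to a certificate -/

namespace StarSystem

open Finset
variable {n : ℕ} {D : StarSystem n} {v : ℕ → Fin n} {S : Finset (Fin n)} {i : ℕ}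

/-- The vertex `v i` describes what remains of star `i` after cutting off `S`. -/
structure Describes (D : StarSystem n) (v : ℕ → Fin n) (S : Finset (Fin n)) (i : ℕ) : Prop where
  kept_le : ∀ r < D.c, r ≠ D.winner v i → D.kept S i r + D.pwin v i ≤ D.top v i
  winner_le : D.winner v i ≠ D.c → D.kept S i (D.winner v i) ≤ D.top v i
  card_eq : D.winner v i ≠ D.c →
    #{u ∈ D.leaves i (D.winner v i) | D.lt u (v i)} = #{u ∈ D.leaves i (D.winner v i) | u ∈ S}
  uniq_iff : D.winner v i = D.p ↔ D.IsUniq S i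
  isCol : D.winner v i ≠ D.p → D.winner v i ≠ D.c → D.IsCol S i (D.winner v i)

/-- If the cut leaves of color `q` are traded for equally many lightest ones, the kept weight does
not decrease, and `v` is the first leaf then kept. If all leaves are cut, a center of color `q` and
positive weight serves instead, as all leaves precede it. -/
theorem exists_threshold (hS : Disjoint S D.ctr) {q : ℕ} (hq : 0 < D.kept S i q) :
    ∃ v, D.col v = q ∧ #{u ∈ D.leaves i q | D.lt u v} = #{u ∈ D.leaves i q | u ∈ S} ∧
      D.kept S i q ≤ D.threshold i v := by
  have hleaf : ∀ u ∈ D.leaves i q, u ∉ D.ctr := fun u hu => (mem_leaves.1 hu).1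
  have hv : ∃ v, D.col v = q ∧ #{u ∈ D.leaves i q | D.lt u v} = #{u ∈ D.leaves i q | u ∈ S} := by
    rcases (card_filter_le (D.leaves i q) (· ∈ S)).lt_or_eq with hlt | heq
    · obtain ⟨v, hv, h⟩ := exists_rank (D := D) hleaf hlt
      exact ⟨v, (mem_leaves.1 hv).2.2.2, h⟩
    · have hall := filter_eq_self.1 (eq_of_subset_of_card_le (filter_subset _ _) heq.ge)
      rw [kept_eq hS, filter_eq_empty_iff.2 (fun u hu => not_not.2 (hall u hu)), sum_empty,
        add_zero, base] at hq
      obtain ⟨v, hv, -⟩ := exists_ne_zero_of_sum_ne_zero hq.ne'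
      simp only [mem_filter, mem_univ, true_and] at hv
      refine ⟨v, hv.2.2, ?_⟩
      rw [heq, filter_true_of_mem fun u _ => .inl hv.1]
  obtain ⟨v, rfl, hcard⟩ := hv
  refine ⟨v, rfl, hcard, ?_⟩
  rw [kept_eq hS, threshold_eq]
  have h1 := sum_filter_add_sum_filter_not (D.leaves i (D.col v)) (fun u => u ∈ S) D.w
  have h2 := sum_filter_add_sum_filter_not (D.leaves i (D.col v)) (fun u => D.lt u v) D.w
  have h3 : ∑ u ∈ D.leaves i (D.col v) with D.lt u v, D.w u ≤
      ∑ u ∈ D.leaves i (D.col v) with u ∈ S, D.w u := by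
    refine sum_le_sum_of_lower (fun x hx y hy hxy => ?_) hcard.le
    rw [mem_filter] at hx hy hxy
    have hx' := hx.2
    have hy' : ¬ D.lt y v := fun h => hxy ⟨hy.1, h⟩
    simp only [lt, not_or] at hx' hy'
    simp only [hy'.1, false_or] at hx'
    omega
  omega

/-- If `p` is the unique maximum, it is the winner, of positive weight because there is a second
color. Otherwise some color other than `p` attains the maximum and is declared the winner. If that
maximum is zero, any center has threshold zero and produces the dummy winner `c`. -/
theorem exists_describes (hD : D.WellFormed) (hc : 2 ≤ D.c) (hS : Disjoint S D.ctr)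
    (hi : i < D.m) : ∃ v, D.Describes (fun _ => v) S i := by
  have hp := hD.p_lt
  by_cases hu : D.IsUniq S i
  · have hpos : 0 < D.kept S i D.p := by
      have : ∃ r < D.c, r ≠ D.p := by
        by_cases h0 : D.p = 0
        · exact ⟨1, by omega, by omega⟩
        · exact ⟨0, by omega, by omega⟩
      obtain ⟨r, hr, hrp⟩ := this
      exact (Nat.zero_le _).trans_lt (hu r hr hrp)
    obtain ⟨v, hvp, hcard, hle⟩ := exists_threshold hS hpos
    have hw : D.winner (fun _ => v) i = D.p := by
      rw [winner, if_pos ⟨hi, by omega⟩, hvp]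
    have ht : D.top (fun _ => v) i = D.threshold i v := if_pos hi
    refine ⟨v, fun r hr hrw => ?_, fun _ => ?_, fun _ => ?_, ?_, fun h => absurd hw h⟩
    · rw [pwin, if_pos hw, ht]
      rw [hw] at hrw
      have := hu r hr hrw
      omega
    · rw [hw, ht]; exact hle
    · rw [hw]; exact hcard
    · exact iff_of_true hw hu
  · have hcol : ∃ r < D.c, r ≠ D.p ∧ D.IsCol S i r := by
      obtain ⟨r, hr, hmax⟩ := exists_max_image (range D.c) (D.kept S i) ⟨D.p, mem_range.2 hp⟩
      by_cases hrp : r = D.p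
      · simp only [IsUniq, not_forall, not_lt] at hu
        obtain ⟨r', hr', hrp', hle⟩ := hu
        refine ⟨r', hr', hrp', fun r'' hr'' => ?_⟩
        have := hmax r'' (mem_range.2 hr'')
        rw [hrp] at this
        omega
      · exact ⟨r, mem_range.1 hr, hrp, fun r' hr' => hmax r' (mem_range.2 hr')⟩
    obtain ⟨r, hr, hrp, hmax⟩ := hcol
    rcases Nat.eq_zero_or_pos (D.kept S i r) with h0 | hpos
    · obtain ⟨v, hv, hsv⟩ := hD.exists_center i hi
      have hthr : D.threshold i v = 0 := by
        have h1 := hmax (D.col v) (hD.col_lt v)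
        rw [kept_eq hS] at h1
        rw [threshold_eq, filter_eq_empty_iff.2 (fun u _ => not_not.2 (.inl hv)), sum_empty]
        omega
      have hw : D.winner (fun _ => v) i = D.c := by simp [winner, hthr]
      have ht : D.top (fun _ => v) i = 0 := by rw [top, if_pos hi, hthr]
      refine ⟨v, fun r' hr' hrw => ?_, fun h => absurd hw h, fun h => absurd hw h, ?_,
        fun _ h => absurd hw h⟩
      · rw [pwin, hw, if_neg hp.ne', ht]
        have := hmax r' hr'
        omega
      · rw [hw]; exact iff_of_false hp.ne' hu
    · obtain ⟨v, hvp, hcard, hle⟩ := exists_threshold hS hpos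
      have hw : D.winner (fun _ => v) i = r := by
        rw [winner, if_pos ⟨hi, by omega⟩, hvp]
      have ht : D.top (fun _ => v) i = D.threshold i v := if_pos hi
      refine ⟨v, fun r' hr' hrw => ?_, fun _ => ?_, fun _ => ?_, ?_, fun _ _ => ?_⟩
      · rw [pwin, hw, if_neg hrp, ht]
        have := hmax r' hr'
        omega
      · rw [hw, ht]; exact hle
      · rw [hw]; exact hcard
      · rw [hw]; exact iff_of_false hrp hu
      · rw [hw]; exact hmax

/-- The leaves of positive weight and color `r` in `S`. -/
def cut (D : StarSystem n) (S : Finset (Fin n)) (r : ℕ) : Finset (Fin n) :=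
  {u ∈ S | D.w u ≠ 0 ∧ D.col u = r}

theorem filter_cut (hS : Disjoint S D.ctr) (i r : ℕ) :
    ({u ∈ D.cut S r | D.s u = i} : Finset _) = {u ∈ D.leaves i r | u ∈ S} := by
  ext u
  simp only [cut, mem_filter, mem_leaves]
  have : u ∈ S → u ∉ D.ctr := fun h => disjoint_left.1 hS h
  tauto

theorem filter_lo (i r : ℕ) : ({u ∈ D.lo v r | D.s u = i} : Finset _) =
    {u ∈ D.leaves i r | if r = D.winner v i then D.lt u (v i)
      else D.top v i < D.upto u + D.pwin v i} := by
  ext u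
  simp only [mem_filter, mem_leaves, mem_lo]
  constructor
  · rintro ⟨⟨h1, h2, h3, h4⟩, rfl⟩; exact ⟨⟨h1, h2, rfl, h3⟩, h4⟩
  · rintro ⟨⟨h1, h2, rfl, h3⟩, h4⟩; exact ⟨⟨h1, h2, h3, h4⟩, rfl⟩

theorem filter_mid (i r : ℕ) : ({u ∈ D.mid v r | D.s u = i} : Finset _) =
    {u ∈ D.leaves i r | if r = D.winner v i then D.lt u (v i) else D.top v i ≤ D.upto u} := by
  ext u
  simp only [mem_filter, mem_leaves, mem_mid]
  constructor
  · rintro ⟨⟨h1, h2, h3, h4⟩, rfl⟩; exact ⟨⟨h1, h2, rfl, h3⟩, h4⟩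
  · rintro ⟨⟨h1, h2, rfl, h3⟩, h4⟩; exact ⟨⟨h1, h2, h3, h4⟩, rfl⟩

theorem filter_hi (i r : ℕ) : ({u ∈ D.hi v r | D.s u = i} : Finset _) =
    {u ∈ D.leaves i r | r = D.winner v i → D.lt u (v i)} := by
  ext u
  simp only [mem_filter, mem_leaves, mem_hi]
  constructor
  · rintro ⟨⟨h1, h2, h3, h4⟩, rfl⟩; exact ⟨⟨h1, h2, rfl, h3⟩, h4⟩
  · rintro ⟨⟨h1, h2, rfl, h3⟩, h4⟩; exact ⟨⟨h1, h2, h3, h4⟩, rfl⟩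

theorem card_eq_sum_stars (hD : D.WellFormed) (T : Finset (Fin n)) :
    #T = ∑ i ∈ range 2, #{u ∈ T | D.s u = i} :=
  card_eq_sum_card_fiberwise fun u _ => by
    have := hD.s_lt u
    have := hD.m_le
    simp only [coe_range, Set.mem_Iio]
    omega

namespace Describes

variable (h : D.Describes v S i) (hS : Disjoint S D.ctr)
include h

/-- The value `top` bounds the kept weight of every color, although `S` itself need not attain it.
-/
theorem isCol_of_top_le {r : ℕ} (hr : D.top v i ≤ D.kept S i r) : D.IsCol S i r := by
  intro r' hr'
  by_cases hw : r' = D.winner v i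
  · have := h.winner_le (by omega)
    rw [← hw] at this
    omega
  · have := h.kept_le r' hr' hw
    omega

include hS

theorem isCol_of_tie {r : ℕ} (hr : r < D.c) (hrp : r ≠ D.p)
    (ht : r = D.winner v i ∨ D.top v i ≤ D.base i r) : D.IsCol S i r := by
  rcases ht with hw | hb
  · rw [hw]; exact h.isCol (by omega) (by omega)
  · refine h.isCol_of_top_le ?_
    rw [kept_eq hS]
    omega

/-- The set `S` need not contain `lo`; only the sizes compare, through `card_le_of_kept_lt`. -/
theorem card_lo_le {r : ℕ} (hr : r < D.c) :
    #{u ∈ D.lo v r | D.s u = i} ≤ #{u ∈ D.cut S r | D.s u = i} := by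
  rw [filter_lo, filter_cut hS]
  by_cases hw : r = D.winner v i
  · subst hw
    simp only [if_true]
    exact (h.card_eq hr.ne).le
  · simp only [if_neg hw]
    have h1 := h.kept_le r hr hw
    rw [kept_eq hS] at h1
    refine le_trans (card_le_card fun u hu => ?_)
      (card_le_of_kept_lt (N := D.top v i + 1 - D.pwin v i) (by omega))
    rw [mem_filter] at hu ⊢
    exact ⟨hu.1, by omega⟩

-- The trade of a leaf for a tie. If `r` stays below `top`, at least as many leaves are cut as `mid`
-- has. If it reaches `top`, the cut may be one leaf short of `mid`, and the resulting tie
-- compensates.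
open Classical in
theorem card_mid_le {r : ℕ} (hr : r < D.c) (hrp : r ≠ D.p) :
    #{u ∈ D.mid v r | D.s u = i} +
        (if r = D.winner v i ∨ D.top v i ≤ D.base i r then 1 else 0) ≤
      #{u ∈ D.cut S r | D.s u = i} + if D.IsCol S i r then 1 else 0 := by
  rw [filter_mid, filter_cut hS]
  by_cases hw : r = D.winner v i
  · subst hw
    simp only [if_true, true_or]
    rw [if_pos (h.isCol hrp hr.ne), h.card_eq hr.ne]
  · simp only [hw, if_false, false_or]
    have h1 := h.kept_le r hr hw
    have hk := kept_eq hS i r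
    by_cases hlt : D.kept S i r < D.top v i
    · rw [if_neg (by omega)]
      have := card_le_of_kept_lt (D := D) (S := S) (i := i) (r := r) (N := D.top v i) (by omega)
      omega
    · rw [if_pos (h.isCol_of_top_le (not_lt.1 hlt))]
      rcases ({u ∈ D.leaves i r | u ∉ S} : Finset _).eq_empty_or_nonempty with he | ⟨t, ht⟩
      · have hall : ({u ∈ D.leaves i r | u ∈ S} : Finset _) = D.leaves i r :=
          filter_true_of_mem fun u hu => not_not.1 (filter_eq_empty_iff.1 he hu)
        rw [hall]
        refine Nat.add_le_add (card_filter_le _ _) ?_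
        split_ifs <;> omega
      · have ht' := mem_filter.1 ht
        have hw0 := (mem_leaves.1 ht'.1).2.1
        have hsplit : ({u ∈ D.leaves i r | u ∉ S} : Finset _) =
            insert t ({u ∈ D.leaves i r | u ∉ insert t S} : Finset _) := by
          ext u
          by_cases hut : u = t
          · subst hut; simp [ht'.1, ht'.2]
          · simp [hut]
        -- The kept leaf `t` has positive weight and the kept weight is at most `top`. So cutting
        -- `t` as well brings `r` strictly below `top`, and the base alone is below `top` too.
        rw [hsplit, sum_insert (by simp)] at hk
        have h2 := card_le_of_kept_lt (D := D) (S := insert t S) (i := i) (r := r)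
          (N := D.top v i) (by omega)
        have h3 : #{u ∈ D.leaves i r | u ∈ insert t S} ≤ #{u ∈ D.leaves i r | u ∈ S} + 1 := by
          refine le_trans (card_le_card (t := insert t ({u ∈ D.leaves i r | u ∈ S} : Finset _))
            fun u hu => ?_) (card_insert_le _ _)
          simp only [mem_filter, mem_insert] at hu ⊢
          tauto
        rw [if_neg (by omega)]
        omega

theorem card_le_hi {r : ℕ} (hr : r < D.c) :
    #{u ∈ D.cut S r | D.s u = i} ≤ #{u ∈ D.hi v r | D.s u = i} := by
  rw [filter_hi, filter_cut hS]
  by_cases hw : r = D.winner v i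
  · subst hw
    simp only [true_imp_iff]
    exact (h.card_eq hr.ne).ge
  · simp only [hw, false_imp_iff, filter_true]
    exact card_filter_le _ _

end Describes

section
variable (hD : D.WellFormed) (hi : D.m ≤ i)
include hD hi

theorem filter_s_eq_empty (T : Finset (Fin n)) : ({u ∈ T | D.s u = i} : Finset _) = ∅ :=
  filter_eq_empty_iff.2 fun u _ h => by have := hD.s_lt u; omega

theorem base_eq_zero (r : ℕ) : D.base i r = 0 :=
  sum_eq_zero fun u hu => by
    have := hD.s_lt u
    simp only [mem_filter] at hu
    omega

omit hD in
theorem winner_of_le : D.winner v i = D.c := if_neg fun h => by omega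

omit hD in
theorem top_of_le : D.top v i = 1 := if_neg fun h => by omega

end

theorem card_filter_range_m (hD : D.WellFormed) (P : ℕ → Prop) [DecidablePred P] :
    #{i ∈ range D.m | P i} = ∑ i ∈ range 2, if i < D.m ∧ P i then 1 else 0 := by
  rw [← card_filter]
  congr 1
  ext i
  have := hD.m_le
  simp only [mem_filter, mem_range]
  constructor
  · rintro ⟨h1, h2⟩; exact ⟨by omega, h1, h2⟩
  · rintro ⟨h1, h2, h3⟩; exact ⟨h2, h3⟩

/-- The set `S` supplies the numbers: `z` counts its leaves of weight zero and `d + 1 + z` the parts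
won by `p`. The bounds on leaf counts and ties follow by adding up the comparisons for the single
stars. -/
theorem exists_isCertificate (hD : D.WellFormed) (hc : 2 ≤ D.c) (hS : Disjoint S D.ctr)
    (hb : D.Balanced S) :
    ∃ v d z, d < n ∧ z < n ∧ D.IsCertificate v (#S + D.m) d z := by
  classical
  have hm := hD.m_le
  have hp := hD.p_lt
  have hv : ∃ v : ℕ → Fin n, ∀ i < D.m, D.Describes v S i := by
    have hne : ∀ i, ∃ v, i < D.m → D.Describes (fun _ => v) S i := by
      intro i
      by_cases hi : i < D.m
      · obtain ⟨v, hv⟩ := exists_describes hD hc hS hi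
        exact ⟨v, fun _ => hv⟩
      -- For an absent star the vertex is irrelevant, but one has to exist. Without any stars, `p`
      -- can win only through a nonempty `S`.
      · by_cases h0 : 0 < D.m
        · obtain ⟨u, -, -⟩ := hD.exists_center 0 h0
          exact ⟨u, fun h => absurd h hi⟩
        · obtain ⟨r, hr, hrp⟩ : ∃ r < D.c, r ≠ D.p := by
            by_cases h0 : D.p = 0
            · exact ⟨1, by omega, by omega⟩
            · exact ⟨0, by omega, by omega⟩
          have := hb r hr hrp
          obtain ⟨u, hu⟩ : S.Nonempty := by
            by_contra hS0
            rw [not_nonempty_iff_eq_empty] at hS0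
            simp [hS0, Nat.eq_zero_of_not_pos h0] at this
          exact ⟨u, fun h => absurd h hi⟩
    choose f hf using hne
    exact ⟨f, fun i hi => ⟨(hf i hi).1, (hf i hi).2, (hf i hi).3, (hf i hi).4, (hf i hi).5⟩⟩
  obtain ⟨v, hv⟩ := hv
  set z := #{u ∈ S | D.w u = 0} with hz
  set W := #{i ∈ range D.m | D.IsUniq S i} with hW
  have hbal : ∀ r < D.c, r ≠ D.p →
      #(D.cut S r) + z + #{i ∈ range D.m | D.IsCol S i r} < #(D.cut S D.p) + W := by
    intro r hr hrp
    unfold cut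
    convert hb r hr hrp
  have hpos : z + 1 ≤ #(D.cut S D.p) + W := by
    obtain ⟨r, hr, hrp⟩ : ∃ r < D.c, r ≠ D.p := by
      by_cases h0 : D.p = 0
      · exact ⟨1, by omega, by omega⟩
      · exact ⟨0, by omega, by omega⟩
    have := hbal r hr hrp
    omega
  have hpwin : D.pwin v 0 + D.pwin v 1 = W := by
    rw [hW, card_filter_range_m hD]
    have : ∀ i, D.pwin v i = if i < D.m ∧ D.IsUniq S i then 1 else 0 := by
      intro i
      rw [pwin]
      by_cases hi : i < D.m
      · simp only [(hv i hi).uniq_iff, hi, true_and]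
      · rw [winner_of_le (not_lt.1 hi), if_neg hp.ne', if_neg (by tauto)]
    rw [sum_range_succ, sum_range_one, this, this]
  have hlo : ∀ r < D.c, #(D.lo v r) ≤ #(D.cut S r) := by
    intro r hr
    rw [card_eq_sum_stars hD, card_eq_sum_stars hD (D.cut S r)]
    refine sum_le_sum fun i _ => ?_
    by_cases hi : i < D.m
    · exact (hv i hi).card_lo_le hS hr
    · simp [filter_s_eq_empty hD (not_lt.1 hi)]
  have hhi : ∀ r < D.c, #(D.cut S r) ≤ #(D.hi v r) := by
    intro r hr
    rw [card_eq_sum_stars hD, card_eq_sum_stars hD (D.hi v r)]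
    refine sum_le_sum fun i _ => ?_
    by_cases hi : i < D.m
    · exact (hv i hi).card_le_hi hS hr
    · simp [filter_s_eq_empty hD (not_lt.1 hi)]
  have hnotie : ∀ r < D.c, ∀ i, ¬ i < D.m → ¬ (r = D.winner v i ∨ D.top v i ≤ D.base i r) := by
    intro r hr i hi
    rw [winner_of_le (not_lt.1 hi), top_of_le (not_lt.1 hi), base_eq_zero hD (not_lt.1 hi)]
    omega
  have hmid : ∀ r < D.c, r ≠ D.p → #(D.mid v r) + D.ties v r ≤
      #(D.cut S r) + #{i ∈ range D.m | D.IsCol S i r} := by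
    intro r hr hrp
    rw [card_eq_sum_stars hD, card_eq_sum_stars hD (D.cut S r), ties, card_filter_range_m hD,
      ← sum_add_distrib, ← sum_add_distrib]
    refine sum_le_sum fun i _ => ?_
    by_cases hi : i < D.m
    · simpa [hi] using (hv i hi).card_mid_le hS hr hrp
    · rw [if_neg (hnotie r hr i hi)]
      simp [filter_s_eq_empty hD (not_lt.1 hi)]
  have hties : ∀ r < D.c, r ≠ D.p → D.ties v r ≤ #{i ∈ range D.m | D.IsCol S i r} := by
    intro r hr hrp
    rw [ties, card_filter_range_m hD]
    refine sum_le_sum fun i _ => ?_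
    by_cases hi : i < D.m
    · by_cases ht : r = D.winner v i ∨ D.top v i ≤ D.base i r
      · rw [if_pos ht, if_pos ⟨hi, (hv i hi).isCol_of_tie hS hr hrp ht⟩]
      · rw [if_neg ht]; omega
    · rw [if_neg (hnotie r hr i hi)]; omega
  have hcard : #S = ∑ r ∈ range D.c with r ≠ D.p, #(D.cut S r) + #(D.cut S D.p) + z := by
    rw [← card_filter_add_card_filter_not (s := S) (fun u => D.w u = 0), add_comm _ z,
      filter_ne', sum_erase_add _ _ (mem_range.2 hp),
      card_eq_sum_card_fiberwise (s := {u ∈ S | ¬ D.w u = 0}) (f := D.col) (t := range D.c)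
        fun u _ => by simpa using hD.col_lt u]
    simp only [cut, filter_filter]
    rfl
  have hn : #S + D.m ≤ n := by
    have h1 : D.m ≤ #D.ctr := by
      have : range D.m ⊆ D.ctr.image D.s := by
        intro i hi
        obtain ⟨u, hu, h⟩ := hD.exists_center i (mem_range.1 hi)
        exact mem_image.2 ⟨u, hu, h⟩
      simpa using (card_le_card this).trans card_image_le
    have h2 := card_le_univ (S ∪ D.ctr)
    rw [card_union_of_disjoint hS, Fintype.card_fin] at h2
    omega
  have hWm : W ≤ D.m := by simpa using card_filter_le (range D.m) (D.IsUniq S)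
  -- The subtraction is not truncated, by `hpos`. Both numbers are below `n` because `#S + m ≤ n`
  -- and `W ≤ m`.
  refine ⟨v, #(D.cut S D.p) + W - z - 1, z, by omega, by omega, ?_⟩
  refine ⟨fun r hr i _ hw => ?_, fun r hr hrp => ?_, ?_, ?_, ?_, ?_, ?_⟩
  · by_cases hi : i < D.m
    · have := (hv i hi).kept_le r hr hw
      rw [kept_eq hS] at this
      omega
    · rw [base_eq_zero hD (not_lt.1 hi), pwin, winner_of_le (not_lt.1 hi), if_neg hp.ne']
      omega
  · have := hmid r hr hrp
    have := hbal r hr hrp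
    omega
  · refine card_le_card fun u hu => ?_
    rw [mem_filter] at hu
    simp only [zeros, mem_filter, mem_univ, true_and]
    exact ⟨disjoint_left.1 hS hu.1, hu.2⟩
  · have := hlo D.p hp
    omega
  · have := hhi D.p hp
    omega
  · have : ∑ r ∈ range D.c with r ≠ D.p, #(D.lo v r) ≤
        ∑ r ∈ range D.c with r ≠ D.p, #(D.cut S r) :=
      sum_le_sum fun r hr => hlo r (mem_range.1 (mem_filter.1 hr).1)
    omega
  · have : ∑ r ∈ range D.c with r ≠ D.p, #(D.cut S r) ≤ ∑ r ∈ range D.c with r ≠ D.p,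
        min #(D.hi v r) (#(D.cut S D.p) + W - z - 1 - D.ties v r) := by
      refine sum_le_sum fun r hr => ?_
      obtain ⟨hr, hrp⟩ := mem_filter.1 hr
      have hr := mem_range.1 hr
      have h1 := hhi r hr
      have h2 := hbal r hr hrp
      have h3 := hties r hr hrp
      omega
    omega

end StarSystem

/-! ### Trees of diameter three are double stars -/

namespace SimpleGraph

open Finset

variable {V : Type*} {G : SimpleGraph V}

/-- Every vertex but `a` and `b` is a leaf attached to exactly one of the adjacent vertices `a` and
`b`, and each of them has such a leaf. -/
structure IsDoubleStar (G : SimpleGraph V) (a b : V) : Prop where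
  adj : G.Adj a b
  leaf : ∀ u, u ≠ a → u ≠ b → (G.Adj u a ↔ ¬ G.Adj u b)
  not_adj : ∀ u v, u ≠ a → u ≠ b → v ≠ a → v ≠ b → ¬ G.Adj u v
  exists_left : ∃ x, x ≠ b ∧ G.Adj a x
  exists_right : ∃ x, x ≠ a ∧ G.Adj b x

theorem IsDoubleStar.symm {a b : V} (h : G.IsDoubleStar a b) : G.IsDoubleStar b a where
  adj := h.adj.symm
  leaf u hb ha := by have := h.leaf u ha hb; tauto
  not_adj u v h1 h2 h3 h4 := h.not_adj u v h2 h1 h4 h3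
  exists_left := h.exists_right
  exists_right := h.exists_left

/-- Either neighbor is the penultimate vertex of the unique path from `u` to `v`. -/
theorem IsTree.eq_of_adj_of_dist_lt (hG : G.IsTree) {u v w w' : V} (hw : G.Adj v w)
    (hw' : G.Adj v w') (h : G.dist u w < G.dist u v) (h' : G.dist u w' < G.dist u v) : w = w' := by
  have hd : ∀ {x}, G.Adj v x → G.dist u x < G.dist u v → ∃ p : G.Walk u x, ∃ hx : G.Adj x v,
      (p.concat hx).IsPath := by
    intro x hx hlt
    obtain ⟨p, hp⟩ := hG.connected.exists_walk_length_eq_dist u x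
    refine ⟨p, hx.symm, Walk.isPath_of_length_eq_dist _ ?_⟩
    rw [Walk.length_concat, hp]
    have := hG.dist_eq_dist_add_one_of_adj u hx
    omega
  obtain ⟨p, hx, hp⟩ := hd hw h
  obtain ⟨p', hx', hp'⟩ := hd hw' h'
  have := (hG.existsUnique_path u v).unique hp hp'
  have h2 := congrArg Walk.penultimate this
  simpa using h2

/-- Take a path `x, a, b, y` realizing the diameter. The distance from a vertex `u` changes by
exactly one along each edge and has no peak at `a` or `b`, since the neighbor closer to `u` is
unique. As it never exceeds three, `u` is one of `a`, `b` or adjacent to one of them. -/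
theorem IsTree.exists_isDoubleStar (hG : G.IsTree) (hd : G.diam = 3) :
    ∃ a b, G.IsDoubleStar a b := by
  have hconn := hG.connected
  have := hconn.nonempty
  have hle : ∀ u v, G.dist u v ≤ 3 := fun u v =>
    hd ▸ dist_le_diam (ediam_ne_top_of_diam_ne_zero (by omega))
  obtain ⟨x, y, hxy⟩ := G.exists_dist_eq_diam
  rw [hd] at hxy
  obtain ⟨p, hp⟩ := hconn.exists_walk_length_eq_dist x y
  rw [hxy] at hp
  obtain ⟨a, b, hxa, hab, hby⟩ : ∃ a b, G.Adj x a ∧ G.Adj a b ∧ G.Adj b y := by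
    match p, hp with
    | .cons h₁ (.cons h₂ (.cons h₃ .nil)), _ => exact ⟨_, _, h₁, h₂, h₃⟩
  have hxa1 := dist_eq_one_iff_adj.2 hxa
  have hab1 := dist_eq_one_iff_adj.2 hab
  have hby1 := dist_eq_one_iff_adj.2 hby
  have hxb : x ≠ b := by
    rintro rfl
    omega
  have hay : a ≠ y := by
    rintro rfl
    omega
  have step := fun u => fun {v w} (h : G.Adj v w) => hG.dist_eq_dist_add_one_of_adj u h
  have near : ∀ u, u ≠ a → u ≠ b → G.Adj u a ∨ G.Adj u b := by
    intro u hua hub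
    have h1 := step u hxa
    have h2 := step u hab
    have h3 := step u hby
    have h4 := hle u x
    have h5 := hle u y
    have h6 := hconn.pos_dist_of_ne hua
    have h7 := hconn.pos_dist_of_ne hub
    have h8 : ¬ (G.dist u x < G.dist u a ∧ G.dist u b < G.dist u a) := fun h =>
      hxb (hG.eq_of_adj_of_dist_lt hxa.symm hab h.1 h.2)
    have h9 : ¬ (G.dist u a < G.dist u b ∧ G.dist u y < G.dist u b) := fun h =>
      hay (hG.eq_of_adj_of_dist_lt hab.symm hby h.1 h.2)
    rw [← dist_eq_one_iff_adj, ← dist_eq_one_iff_adj]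
    omega
  have notboth : ∀ u, ¬ (G.Adj u a ∧ G.Adj u b) := by
    rintro u ⟨h1, h2⟩
    have := hG.dist_ne_of_adj u hab
    rw [dist_eq_one_iff_adj.2 h1, dist_eq_one_iff_adj.2 h2] at this
    exact this rfl
  have same : ∀ u v c, G.Adj u c → G.Adj v c → ¬ G.Adj u v := by
    intro u v c h1 h2 h3
    have := hG.dist_ne_of_adj c h3
    rw [dist_eq_one_iff_adj.2 h1.symm, dist_eq_one_iff_adj.2 h2.symm] at this
    exact this rfl
  -- Otherwise `v` would have two different neighbors, `u` and `b`, closer to `a`.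
  have cross : ∀ u v, u ≠ b → G.Adj u a → G.Adj v b → v ≠ a → ¬ G.Adj u v := by
    intro u v hub h1 h2 hva h3
    have hd1 := dist_eq_one_iff_adj.2 h1.symm
    have hd2 : G.dist a v = 2 := by
      have hs := step a h3
      have := hconn.pos_dist_of_ne hva.symm
      omega
    exact hub (hG.eq_of_adj_of_dist_lt h3.symm h2 (by omega : G.dist a u < _) (by omega))
  refine ⟨a, b, hab, fun u hua hub => ?_, fun u v hua hub hva hvb huv => ?_, ⟨x, hxb, hxa.symm⟩,
    ⟨y, hay.symm, hby⟩⟩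
  · have := near u hua hub
    have := notboth u
    tauto
  · rcases near u hua hub with h1 | h1 <;> rcases near v hva hvb with h2 | h2
    · exact same u v a h1 h2 huv
    · exact cross u v hub h1 h2 hva huv
    · exact cross v u hvb h2 h1 hua huv.symm
    · exact same u v b h1 h2 huv

end SimpleGraph

/-! ### Connected partitions of a double star -/

namespace Gerrymandering

open Finset

variable {n c : ℕ}

open Classical in
/-- The stars into which a double star with centers `a` and `b` falls apart: the whole graph if
`m = 1`, and the stars around `a` and `b` if `m = 2`. -/
noncomputable def Instance.stars (I : Instance n c) (a b : Fin n) (m : ℕ) : StarSystem n where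
  w := I.w
  col u := I.col u
  s u := if m < 2 then 0 else if u = b then 1 else if u = a then 0 else if I.G.Adj a u then 0 else 1
  ctr := {a, b}
  c := c
  p := I.p
  m := m

/-- The part consisting of what remains of star `i` after cutting off `S`. -/
def _root_.StarSystem.rest (D : StarSystem n) (S : Finset (Fin n)) (i : ℕ) : Finset (Fin n) :=
  {u | u ∉ S ∧ D.s u = i}

theorem _root_.StarSystem.mem_rest {D : StarSystem n} {S : Finset (Fin n)} {i : ℕ} {u : Fin n} :
    u ∈ D.rest S i ↔ u ∉ S ∧ D.s u = i := by simp [StarSystem.rest]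

theorem exists_adj_of_connected {V : Type*} {G : SimpleGraph V} {A : Set V}
    (h : (G.induce A).Connected) {x y : V} (hx : x ∈ A) (hy : y ∈ A) (hxy : x ≠ y) :
    ∃ z ∈ A, G.Adj x z := by
  obtain ⟨p⟩ := h.preconnected ⟨x, hx⟩ ⟨y, hy⟩
  cases p with
  | nil => exact absurd rfl hxy
  | cons hadj _ => exact ⟨_, Subtype.coe_prop _, hadj⟩

theorem connected_of_forall_adj {V : Type*} {G : SimpleGraph V} {A : Set V} {x : V} (hx : x ∈ A)
    (h : ∀ y ∈ A, y ≠ x → G.Adj x y ∨ ∃ z ∈ A, G.Adj x z ∧ G.Adj z y) :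
    (G.induce A).Connected := by
  rw [SimpleGraph.connected_iff_exists_forall_reachable]
  refine ⟨⟨x, hx⟩, fun ⟨y, hy⟩ => ?_⟩
  by_cases hyx : y = x
  · subst hyx; rfl
  · rcases h y hy hyx with h1 | ⟨z, hz, h1, h2⟩
    · exact SimpleGraph.Adj.reachable (G := G.induce A) (u := ⟨x, hx⟩) (v := ⟨y, hy⟩) h1
    · exact (SimpleGraph.Adj.reachable (G := G.induce A) (u := ⟨x, hx⟩) (v := ⟨z, hz⟩) h1).trans
        (SimpleGraph.Adj.reachable (G := G.induce A) (u := ⟨z, hz⟩) (v := ⟨y, hy⟩) h2)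

section
variable {I : Instance n c} {a b : Fin n} {m : ℕ}

theorem stars_wellFormed (hab : a ≠ b) (hm : m = 1 ∨ m = 2) : (I.stars a b m).WellFormed where
  col_lt u := (I.col u).2
  p_lt := I.p.2
  s_lt u := by
    simp only [Instance.stars]
    split_ifs <;> omega
  m_le := by simp only [Instance.stars]; omega
  exists_center i hi := by
    simp only [Instance.stars] at hi ⊢
    by_cases h : i = 0
    · refine ⟨a, by simp, ?_⟩
      rw [h]
      simp [hab]
    · refine ⟨b, by simp, ?_⟩
      rw [if_neg (by omega), if_pos rfl]
      omega

/-- The parts of the partition are the singletons of `S` and the remaining stars. -/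
def IsCutBy (I : Instance n c) (a b : Fin n) (m : ℕ) (S : Finset (Fin n))
    (𝒱 : Finpartition (univ : Finset (Fin n))) : Prop :=
  ∀ P, P ∈ 𝒱.parts ↔ (∃ u ∈ S, P = {u}) ∨ ∃ i < m, P = (I.stars a b m).rest S i

theorem rest_nonempty (hab : a ≠ b) (hm : m = 1 ∨ m = 2) {S : Finset (Fin n)}
    (hS : Disjoint S {a, b}) {i : ℕ} (hi : i < m) : ((I.stars a b m).rest S i).Nonempty := by
  obtain ⟨u, hu, h⟩ := (stars_wellFormed (I := I) hab hm).exists_center i hi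
  exact ⟨u, StarSystem.mem_rest.2 ⟨fun huS => disjoint_left.1 hS huS hu, h⟩⟩

theorem exists_isCutBy (hab : a ≠ b) (hm : m = 1 ∨ m = 2) {S : Finset (Fin n)}
    (hS : Disjoint S {a, b}) : ∃ 𝒱, IsCutBy I a b m S 𝒱 := by
  classical
  have hD := stars_wellFormed (I := I) hab hm
  set D := I.stars a b m with hDdef
  have hDm : D.m = m := rfl
  have mem : ∀ P, P ∈ S.image (fun u => ({u} : Finset (Fin n))) ∪ (range m).image (D.rest S) ↔
      (∃ u ∈ S, P = {u}) ∨ ∃ i < m, P = D.rest S i := by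
    intro P
    simp only [mem_union, mem_image, mem_range, eq_comm (a := P)]
  refine ⟨Finpartition.ofExistsUnique
    (S.image (fun u => ({u} : Finset (Fin n))) ∪ (range m).image (D.rest S))
    (fun _ _ => subset_univ _) (fun u _ => ?_) ?_, mem⟩
  · by_cases huS : u ∈ S
    · refine ⟨{u}, ⟨(mem _).2 (.inl ⟨u, huS, rfl⟩), mem_singleton_self u⟩, ?_⟩
      rintro P ⟨hP, huP⟩
      rcases (mem P).1 hP with ⟨u', _, rfl⟩ | ⟨i, _, rfl⟩
      · rw [mem_singleton.1 huP]
      · exact absurd huS (StarSystem.mem_rest.1 huP).1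
    · refine ⟨D.rest S (D.s u), ⟨(mem _).2 (.inr ⟨D.s u, hDm ▸ hD.s_lt u, rfl⟩),
        StarSystem.mem_rest.2 ⟨huS, rfl⟩⟩, ?_⟩
      rintro P ⟨hP, huP⟩
      rcases (mem P).1 hP with ⟨u', hu', rfl⟩ | ⟨i, _, rfl⟩
      · rw [mem_singleton] at huP
        exact absurd (huP ▸ hu') huS
      · rw [(StarSystem.mem_rest.1 huP).2]
  · intro h
    rcases (mem ∅).1 h with ⟨u, _, h⟩ | ⟨i, hi, h⟩
    · exact (singleton_ne_empty u h.symm).elim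
    · exact (rest_nonempty (I := I) hab hm hS hi).ne_empty h.symm

theorem IsCutBy.connected (hG : I.G.IsDoubleStar a b) (hm : m = 1 ∨ m = 2) {S : Finset (Fin n)}
    (hS : Disjoint S {a, b}) {𝒱} (h : IsCutBy I a b m S 𝒱) :
    ∀ A ∈ 𝒱.parts, (I.G.induce (A : Set (Fin n))).Connected := by
  classical
  have hab := hG.adj.ne
  have haS : a ∉ S := fun h => disjoint_left.1 hS h (by simp)
  have hbS : b ∉ S := fun h => disjoint_left.1 hS h (by simp)
  intro A hA
  rcases (h A).1 hA with ⟨u, _, rfl⟩ | ⟨i, hi, rfl⟩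
  · exact connected_of_forall_adj (x := u) (by simp) fun y hy hyu => absurd (by simpa using hy) hyu
  · have memr : ∀ u, u ∈ ((I.stars a b m).rest S i : Set (Fin n)) ↔
        u ∉ S ∧ (I.stars a b m).s u = i := fun u => by rw [mem_coe, StarSystem.mem_rest]
    rcases hm with rfl | rfl
    · have hs : ∀ u, (I.stars a b 1).s u = i := fun u => by
        simp only [Instance.stars, if_pos (by omega : 1 < 2)]; omega
      refine connected_of_forall_adj (x := a) ((memr a).2 ⟨haS, hs a⟩) fun y hy hya => ?_
      by_cases hyb : y = b
      · exact .inl (hyb ▸ hG.adj)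
      · by_cases hadj : I.G.Adj y a
        · exact .inl hadj.symm
        · exact .inr ⟨b, (memr b).2 ⟨hbS, hs b⟩, hG.adj,
            (not_not.1 (mt (hG.leaf y hya hyb).2 hadj)).symm⟩
    · have hs : ∀ u, (I.stars a b 2).s u =
          if u = b then 1 else if u = a then 0 else if I.G.Adj a u then 0 else 1 := fun u => rfl
      by_cases hi0 : i = 0
      · subst hi0
        refine connected_of_forall_adj (x := a) ((memr a).2 ⟨haS, by simp [hs, hab]⟩)
          fun y hy hya => ?_
        have h2 := ((memr y).1 hy).2
        rw [hs] at h2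
        split_ifs at h2 with h3 h4
        exact .inl h4
      · obtain rfl : i = 1 := by omega
        refine connected_of_forall_adj (x := b) ((memr b).2 ⟨hbS, by simp [hs]⟩)
          fun y hy hyb => ?_
        have h2 := ((memr y).1 hy).2
        rw [hs, if_neg hyb] at h2
        split_ifs at h2 with h3 h4
        have := hG.leaf y h3 hyb
        rw [I.G.adj_comm] at h4
        exact .inl (not_not.1 (mt this.2 h4)).symm

/-- In a connected part with several vertices, any leaf comes with its center. So the parts without
centers are singletons, and `S` collects their elements. -/
theorem exists_isCutBy_of_connected (hG : I.G.IsDoubleStar a b)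
    (𝒱 : Finpartition (univ : Finset (Fin n)))
    (hconn : ∀ A ∈ 𝒱.parts, (I.G.induce (A : Set (Fin n))).Connected) :
    ∃ m S, (m = 1 ∨ m = 2) ∧ Disjoint S {a, b} ∧ IsCutBy I a b m S 𝒱 := by
  classical
  have hab := hG.adj.ne
  have hself : ∀ u, u ∈ 𝒱.part u := fun u => 𝒱.mem_part_self.2 (mem_univ u)
  have hpart : ∀ u, 𝒱.part u ∈ 𝒱.parts := fun u => 𝒱.part_mem.2 (mem_univ u)
  have hnb : ∀ u, u ≠ a → u ≠ b → ∀ P ∈ 𝒱.parts, u ∈ P → ∀ x ∈ P, x ≠ u →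
      (a ∈ P ∧ I.G.Adj u a) ∨ (b ∈ P ∧ I.G.Adj u b) := by
    intro u hua hub P hP huP x hx hxu
    obtain ⟨z, hz, hadj⟩ := exists_adj_of_connected (hconn P hP) (mem_coe.2 huP) (mem_coe.2 hx)
      hxu.symm
    by_cases hza : z = a
    · subst hza; exact .inl ⟨hz, hadj⟩
    by_cases hzb : z = b
    · subst hzb; exact .inr ⟨hz, hadj⟩
    exact absurd hadj (hG.not_adj u z hua hub hza hzb)
  have hsingle : ∀ P ∈ 𝒱.parts, a ∉ P → b ∉ P → ∀ u ∈ P, P = {u} := by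
    intro P hP ha hb u hu
    ext x
    rw [mem_singleton]
    constructor
    · intro hx
      by_contra hxu
      rcases hnb u (fun h => ha (h ▸ hu)) (fun h => hb (h ▸ hu)) P hP hu x hx hxu with h | h
      · exact ha h.1
      · exact hb h.1
    · rintro rfl; exact hu
  -- Here `C i` are the parts containing the centers, so that centers together and centers apart are
  -- treated alike.
  have main : ∀ m, ∀ C : ℕ → Finset (Fin n), (m = 1 ∨ m = 2) → (∀ i < m, C i ∈ 𝒱.parts) →
      (∃ i < m, a ∈ C i) → (∃ i < m, b ∈ C i) →
      (∀ i < m, ∀ u ∈ C i, (I.stars a b m).s u = i) →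
      ∃ m S, (m = 1 ∨ m = 2) ∧ Disjoint S {a, b} ∧ IsCutBy I a b m S 𝒱 := by
    intro m C hm hC ha hb hs
    set S : Finset (Fin n) := {u | ∀ i < m, u ∉ C i} with hSdef
    have memS : ∀ u, u ∈ S ↔ ∀ i < m, u ∉ C i := by simp [hSdef]
    have haS : a ∉ S := fun h => by obtain ⟨i, hi, h'⟩ := ha; exact (memS a).1 h i hi h'
    have hbS : b ∉ S := fun h => by obtain ⟨i, hi, h'⟩ := hb; exact (memS b).1 h i hi h'
    have hrest : ∀ i < m, (I.stars a b m).rest S i = C i := by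
      intro i hi
      ext u
      rw [StarSystem.mem_rest, memS]
      constructor
      · rintro ⟨h1, h2⟩
        simp only [not_forall, not_not] at h1
        obtain ⟨j, hj, huj⟩ := h1
        rw [← h2, hs j hj u huj]
        exact huj
      · exact fun hu => ⟨fun h => h i hi hu, hs i hi u hu⟩
    have hpS : ∀ u ∈ S, 𝒱.part u = {u} := by
      intro u hu
      refine hsingle _ (hpart u) (fun h => ?_) (fun h => ?_) u (hself u)
      · obtain ⟨i, hi, h'⟩ := ha
        have := 𝒱.eq_of_mem_parts (hpart u) (hC i hi) h h'
        exact (memS u).1 hu i hi (this ▸ hself u)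
      · obtain ⟨i, hi, h'⟩ := hb
        have := 𝒱.eq_of_mem_parts (hpart u) (hC i hi) h h'
        exact (memS u).1 hu i hi (this ▸ hself u)
    refine ⟨m, S, hm, ?_, fun P => ⟨fun hP => ?_, ?_⟩⟩
    · rw [disjoint_left]
      intro u hu hu'
      rw [mem_insert, mem_singleton] at hu'
      rcases hu' with rfl | rfl
      · exact haS hu
      · exact hbS hu
    · obtain ⟨u, hu⟩ := 𝒱.nonempty_of_mem_parts hP
      by_cases huS : u ∈ S
      · refine .inl ⟨u, huS, ?_⟩
        rw [← hpS u huS]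
        exact (𝒱.part_eq_of_mem hP hu).symm
      · rw [memS] at huS
        simp only [not_forall, not_not] at huS
        obtain ⟨i, hi, hui⟩ := huS
        refine .inr ⟨i, hi, ?_⟩
        rw [hrest i hi]
        exact 𝒱.eq_of_mem_parts hP (hC i hi) hu hui
    · rintro (⟨u, hu, rfl⟩ | ⟨i, hi, rfl⟩)
      · rw [← hpS u hu]; exact hpart u
      · rw [hrest i hi]; exact hC i hi
  by_cases hbA : b ∈ 𝒱.part a
  · refine main 1 (fun _ => 𝒱.part a) (.inl rfl) (fun _ _ => hpart a) ⟨0, by omega, hself a⟩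
      ⟨0, by omega, hbA⟩ fun i hi u _ => ?_
    simp only [Instance.stars, if_pos (by omega : 1 < 2)]
    omega
  · have haB : a ∉ 𝒱.part b := fun h =>
      hbA ((𝒱.eq_of_mem_parts (hpart a) (hpart b) (hself a) h).symm ▸ hself b)
    refine main 2 (fun i => if i = 0 then 𝒱.part a else 𝒱.part b) (.inr rfl) (fun i _ => ?_)
      ⟨0, by omega, by simp⟩ ⟨1, by omega, by simp⟩
      fun i hi u hu => ?_
    · split_ifs
      · exact hpart a
      · exact hpart b
    · have hs : (I.stars a b 2).s u =
          if u = b then 1 else if u = a then 0 else if I.G.Adj a u then 0 else 1 := rfl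
      rw [hs]
      by_cases hi0 : i = 0
      · subst hi0
        simp only [if_true] at hu
        rw [if_neg (fun h : u = b => hbA (h ▸ hu))]
        split_ifs with h1 h2
        · rfl
        · rfl
        · rcases hnb u h1 (fun h => hbA (h ▸ hu)) _ (hpart a) hu a (hself a) (Ne.symm h1) with h | h
          · exact absurd h.2.symm h2
          · exact absurd h.1 hbA
      · obtain rfl : i = 1 := by omega
        simp only [one_ne_zero, if_false] at hu
        split_ifs with h1 h2 h3
        · rfl
        · exact absurd (h2 ▸ hu) haB
        · rcases hnb u h2 h1 _ (hpart b) hu b (hself b) (Ne.symm h1) with h | h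
          · exact absurd h.1 haB
          · exact absurd h.2 ((hG.leaf u h2 h1).1 h3.symm)
        · rfl

theorem IsCutBy.card_filter (hab : a ≠ b) (hm : m = 1 ∨ m = 2) {S : Finset (Fin n)}
    (hS : Disjoint S {a, b}) {𝒱} (h : IsCutBy I a b m S 𝒱) (Q : Finset (Fin n) → Prop)
    [DecidablePred Q] :
    #{A ∈ 𝒱.parts | Q A} = #{u ∈ S | Q {u}} + #{i ∈ range m | Q ((I.stars a b m).rest S i)} := by
  classical
  have hparts : 𝒱.parts = S.image (fun u => ({u} : Finset (Fin n))) ∪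
      (range m).image ((I.stars a b m).rest S) := by
    ext P
    rw [h P]
    simp only [mem_union, mem_image, mem_range, eq_comm (a := P)]
  have hdisj : Disjoint (S.image (fun u => ({u} : Finset (Fin n))))
      ((range m).image ((I.stars a b m).rest S)) := by
    rw [disjoint_left]
    intro P hP hP'
    obtain ⟨u, hu, rfl⟩ := mem_image.1 hP
    obtain ⟨i, _, hi⟩ := mem_image.1 hP'
    have : u ∈ (I.stars a b m).rest S i := hi ▸ mem_singleton_self u
    exact (StarSystem.mem_rest.1 this).1 hu
  have hinj : Set.InjOn ((I.stars a b m).rest S) {i | i < m} := by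
    intro i hi j hj hij
    obtain ⟨u, hu⟩ := rest_nonempty (I := I) hab hm hS hi
    have hu' := hu
    rw [hij] at hu'
    exact (StarSystem.mem_rest.1 hu).2.symm.trans (StarSystem.mem_rest.1 hu').2
  rw [hparts, filter_union, card_union_of_disjoint (disjoint_filter_filter hdisj), filter_image,
    filter_image, card_image_of_injective _ singleton_injective, card_image_of_injOn]
  intro i hi j hj hij
  simp only [coe_filter, mem_range, Set.mem_ofPred_eq] at hi hj
  exact hinj hi.1 hj.1 hij

theorem colorWeight_rest (S : Finset (Fin n)) (i : ℕ) (r : Fin c) :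
    I.colorWeight r ((I.stars a b m).rest S i) = (I.stars a b m).kept S i r := by
  rw [Instance.colorWeight, StarSystem.rest, StarSystem.kept, filter_filter]
  refine sum_congr (filter_congr fun u _ => ?_) fun _ _ => rfl
  simp only [Instance.stars, and_assoc, Fin.ext_iff]

theorem isColored_rest (S : Finset (Fin n)) (i : ℕ) (r : Fin c) :
    I.IsColored r ((I.stars a b m).rest S i) ↔ (I.stars a b m).IsCol S i r := by
  simp only [Instance.IsColored, StarSystem.IsCol, colorWeight_rest, Fin.forall_iff]
  rfl

theorem isUniquelyColored_rest (S : Finset (Fin n)) (i : ℕ) :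
    I.IsUniquelyColored I.p ((I.stars a b m).rest S i) ↔ (I.stars a b m).IsUniq S i := by
  simp only [Instance.IsUniquelyColored, StarSystem.IsUniq, colorWeight_rest, Fin.forall_iff,
    ne_eq, Fin.ext_iff]
  rfl

theorem colorWeight_singleton (r : Fin c) (u : Fin n) :
    I.colorWeight r {u} = if I.col u = r then I.w u else 0 := by
  rw [Instance.colorWeight, sum_filter, sum_singleton]

theorem isColored_singleton (r : Fin c) (u : Fin n) :
    I.IsColored r {u} ↔ I.w u = 0 ∨ I.col u = r := by
  simp only [Instance.IsColored, colorWeight_singleton]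
  constructor
  · intro h
    have := h (I.col u)
    rw [if_pos rfl] at this
    by_contra hcon
    rw [not_or] at hcon
    rw [if_neg hcon.2] at this
    omega
  · intro h r'
    split_ifs <;> omega

/-- A second color `r` is needed: with `p` alone, a vertex of weight zero would be uniquely colored
vacuously. -/
theorem isUniquelyColored_singleton {r : Fin c} (hr : r ≠ I.p) (u : Fin n) :
    I.IsUniquelyColored I.p {u} ↔ I.w u ≠ 0 ∧ I.col u = I.p := by
  simp only [Instance.IsUniquelyColored, colorWeight_singleton]
  constructor
  · intro h
    by_cases hu : I.col u = I.p
    · have := h r hr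
      rw [if_neg (fun h' => hr (h'.symm.trans hu)), if_pos hu] at this
      exact ⟨by omega, hu⟩
    · have := h (I.col u) hu
      rw [if_pos rfl, if_neg hu] at this
      omega
  · rintro ⟨h1, h2⟩ r' hr'
    rw [if_neg (fun h' => hr' (h'.symm.trans h2)), if_pos h2]
    omega

theorem IsCutBy.isSolution_iff (hG : I.G.IsDoubleStar a b) (hm : m = 1 ∨ m = 2)
    {S : Finset (Fin n)} (hS : Disjoint S {a, b}) {𝒱} (h : IsCutBy I a b m S 𝒱) :
    I.IsSolution 𝒱 ↔ #S + m = I.k ∧ (I.stars a b m).Balanced S := by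
  classical
  have hab := hG.adj.ne
  have hcard : #𝒱.parts = #S + m := by
    have := h.card_filter hab hm hS (fun _ => True)
    simpa using this
  have hbal : (∀ r : Fin c, r ≠ I.p →
      #{A ∈ 𝒱.parts | I.IsColored r A} < #{A ∈ 𝒱.parts | I.IsUniquelyColored I.p A}) ↔
      (I.stars a b m).Balanced S := by
    have hcol : ∀ r : Fin c, #{A ∈ 𝒱.parts | I.IsColored r A} =
        #{u ∈ S | I.w u ≠ 0 ∧ I.col u = r} + #{u ∈ S | I.w u = 0} +
          #{i ∈ range m | (I.stars a b m).IsCol S i r} := by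
      intro r
      rw [h.card_filter hab hm hS]
      congr 1
      · simp only [isColored_singleton]
        rw [← card_union_of_disjoint (disjoint_filter.2 fun u _ h1 h2 => h1.1 h2), ← filter_or]
        congr 1
        refine filter_congr fun u _ => ?_
        tauto
      · simp only [isColored_rest]
    have huniq : ∀ r : Fin c, r ≠ I.p → #{A ∈ 𝒱.parts | I.IsUniquelyColored I.p A} =
        #{u ∈ S | I.w u ≠ 0 ∧ I.col u = I.p} + #{i ∈ range m | (I.stars a b m).IsUniq S i} := by
      intro r hr
      rw [h.card_filter hab hm hS]
      simp only [isUniquelyColored_singleton hr, isUniquelyColored_rest]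
    have hB : (I.stars a b m).Balanced S ↔ ∀ r : Fin c, r ≠ I.p →
        #{u ∈ S | I.w u ≠ 0 ∧ I.col u = r} + #{u ∈ S | I.w u = 0} +
          #{i ∈ range m | (I.stars a b m).IsCol S i r} <
        #{u ∈ S | I.w u ≠ 0 ∧ I.col u = I.p} + #{i ∈ range m | (I.stars a b m).IsUniq S i} := by
      simp only [StarSystem.Balanced, Fin.forall_iff, ne_eq, Fin.ext_iff]
      simp only [Instance.stars]
      refine forall_congr' fun r => forall_congr' fun hr => imp_congr_right fun hrp => ?_
      apply iff_of_eq
      congr!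
    rw [hB]
    refine forall_congr' fun r => imp_congr_right fun hr => ?_
    rw [hcol r, huniq r hr]
  rw [Instance.IsSolution, hcard, ← hbal]
  have := h.connected hG hm hS
  constructor
  · rintro ⟨h1, _, h3⟩
    refine ⟨h1, fun r hr => ?_⟩
    convert h3 r hr
  · rintro ⟨h1, h3⟩
    refine ⟨h1, this, fun r hr => ?_⟩
    convert h3 r hr

theorem isYes_iff (hG : I.G.IsDoubleStar a b) :
    I.IsYes ↔ ∃ m S, (m = 1 ∨ m = 2) ∧ Disjoint S {a, b} ∧ #S + m = I.k ∧
      (I.stars a b m).Balanced S := by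
  constructor
  · rintro ⟨𝒱, h𝒱⟩
    obtain ⟨m, S, hm, hS, h⟩ := exists_isCutBy_of_connected hG 𝒱 h𝒱.2.1
    exact ⟨m, S, hm, hS, (h.isSolution_iff hG hm hS).1 h𝒱⟩
  · rintro ⟨m, S, hm, hS, h⟩
    obtain ⟨𝒱, h𝒱⟩ := exists_isCutBy (I := I) hG.adj.ne hm hS
    exact ⟨𝒱, (h𝒱.isSolution_iff hG hm hS).2 h⟩

theorem isYes_iff_of_two_le (hG : I.G.IsDoubleStar a b) (hc : 2 ≤ c) :
    I.IsYes ↔ ∃ m, (m = 1 ∨ m = 2) ∧ ∃ v d z, d < n ∧ z < n ∧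
      (I.stars a b m).IsCertificate v I.k d z := by
  rw [isYes_iff hG]
  constructor
  · rintro ⟨m, S, hm, hS, hk, hb⟩
    obtain ⟨v, d, z, hd, hz, h⟩ :=
      StarSystem.exists_isCertificate (stars_wellFormed hG.adj.ne hm) hc hS hb
    refine ⟨m, hm, v, d, z, hd, hz, ?_⟩
    rwa [← hk]
  · rintro ⟨m, hm, v, d, z, _, _, h⟩
    obtain ⟨S, hS, hk, hb⟩ := h.exists_balanced (stars_wellFormed hG.adj.ne hm)
    exact ⟨m, S, hm, hS, hk, hb⟩

/-- With a single color the balance condition is void and only the number of parts matters. One star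
yields all `k` from 1 to `n - 1`, two stars yield `k = n`. -/
theorem isYes_iff_of_lt_two (hG : I.G.IsDoubleStar a b) (hc : c < 2) :
    I.IsYes ↔ 0 < I.k ∧ I.k ≤ n := by
  have hab := hG.adj.ne
  have hpair : #({a, b} : Finset (Fin n)) = 2 := card_pair hab
  have hcompl := card_compl_add_card ({a, b} : Finset (Fin n))
  rw [Fintype.card_fin, hpair] at hcompl
  rw [isYes_iff hG]
  constructor
  · rintro ⟨m, S, hm, hS, hk, -⟩
    have := card_le_card (subset_compl_iff_disjoint_right.2 hS)
    omega
  · rintro ⟨h0, hn⟩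
    have hbal : ∀ m S, (I.stars a b m).Balanced S := by
      intro m S r hr hrp
      have hr' : r < c := hr
      have := I.p.2
      have hrp' : r ≠ I.p := hrp
      omega
    by_cases hkn : I.k < n
    · obtain ⟨S, hS, hc⟩ := exists_subset_card_eq
        (s := ({a, b} : Finset (Fin n))ᶜ) (n := I.k - 1) (by omega)
      exact ⟨1, S, .inl rfl, subset_compl_iff_disjoint_right.1 hS, by omega, hbal _ _⟩
    · obtain ⟨S, hS, hc⟩ := exists_subset_card_eq
        (s := ({a, b} : Finset (Fin n))ᶜ) (n := I.k - 2) (by omega)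
      exact ⟨2, S, .inr rfl, subset_compl_iff_disjoint_right.1 hS, by omega, hbal _ _⟩

end
end Gerrymandering

/-! ### Expressions with named variables and their meaning -/

namespace RAM

open Finset

/-- Expressions whose variables are named by their depth. -/
abbrev Gen := ℕ → Expr

namespace Gen

def lit (k : ℕ) : Gen := fun _ => .const k
def add (x y : Gen) : Gen := fun d => .add (x d) (y d)
def sub (x y : Gen) : Gen := fun d => .sub (x d) (y d)
def mem (x : Gen) : Gen := fun d => .mem (x d)
/-- `if a < b then x else y` -/
def ite (a b x y : Gen) : Gen := fun d => .ite (a d) (b d) (x d) (y d)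
-- The new variable is named by the depth of its binder, a name that stays valid under further
-- binders.
def sum (j : Bool) (f : Gen → Gen) : Gen := fun d => .sum j (f (fun _ => .var d) (d + 1))
def bind (x : Gen) (f : Gen → Gen) : Gen := fun d => .bind (x d) (f (fun _ => .var d) (d + 1))
/-- `if a = b then x else y` -/
def eq (a b x y : Gen) : Gen := ite a b y (ite b a y x)

end Gen

/-- The values of the variables below `depth`. -/
structure Ctx where
  depth : ℕ
  val : ℕ → ℕ

instance : Preorder Ctx where
  le C C' := C.depth ≤ C'.depth ∧ ∀ i < C.depth, C'.val i = C.val i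
  le_refl _ := ⟨Nat.le_refl _, fun _ _ => rfl⟩
  le_trans _ _ _ h h' :=
    ⟨h.1.trans h'.1, fun i hi => (h'.2 i (hi.trans_le h.1)).trans (h.2 i hi)⟩

/-- The context with one more variable. -/
def Ctx.push (C : Ctx) (v : ℕ) : Ctx := ⟨C.depth + 1, Function.update C.val C.depth v⟩

theorem Ctx.le_push (C : Ctx) (v : ℕ) : C ≤ C.push v :=
  ⟨Nat.le_succ _, fun _ hi => Function.update_of_ne hi.ne _ _⟩

/-- The value of `x` in the context `C`. -/
def Gen.value (m : ℕ → ℕ) (x : Gen) (C : Ctx) : ℕ := (x C.depth).eval m C.depth C.val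

/-- In all extensions of `C`, the value of `x` is `v`. -/
def Den (m : ℕ → ℕ) (C : Ctx) (x : Gen) (v : ℕ) : Prop := ∀ C', C ≤ C' → x.value m C' = v

/-- In all extensions of `C`, the value of `x` is positive if and only if `Q` holds. -/
def Decides (m : ℕ → ℕ) (C : Ctx) (x : Gen) (Q : Prop) : Prop :=
  ∀ C', C ≤ C' → (0 < x.value m C' ↔ Q)

variable {m : ℕ → ℕ} {C : Ctx} {x y a b : Gen} {v w s t : ℕ} {Q R : Prop}

theorem Den.mono (h : Den m C x v) {C' : Ctx} (hC : C ≤ C') : Den m C' x v :=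
  fun C'' h' => h C'' (hC.trans h')

theorem Decides.of_iff (h : Decides m C x Q) (hQ : Q ↔ R) : Decides m C x R :=
  fun C' h' => (h C' h').trans hQ

theorem Den.decides (h : Den m C x v) : Decides m C x (0 < v) := fun C' h' => by rw [h C' h']

theorem den_var (C : Ctx) (v : ℕ) : Den m (C.push v) (fun _ => .var C.depth) v := by
  intro C' h
  simp only [Gen.value, Expr.eval]
  have hd : C.depth < C'.depth := h.1
  rw [if_pos hd, h.2 C.depth (Nat.lt_succ_self _)]
  exact Function.update_self ..

theorem den_lit (k : ℕ) : Den m C (.lit k) k := fun _ _ => rfl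

theorem Den.add (hx : Den m C x v) (hy : Den m C y w) : Den m C (x.add y) (v + w) := by
  intro C' h
  rw [← hx C' h, ← hy C' h]
  rfl

theorem Den.sub (hx : Den m C x v) (hy : Den m C y w) : Den m C (x.sub y) (v - w) := by
  intro C' h
  rw [← hx C' h, ← hy C' h]
  rfl

theorem Den.mem (hx : Den m C x v) : Den m C x.mem (m v) := by
  intro C' h
  rw [← hx C' h]
  rfl

theorem value_ite (ha : Den m C a s) (hb : Den m C b t) {C' : Ctx} (h : C ≤ C') :
    (Gen.ite a b x y).value m C' = if s < t then x.value m C' else y.value m C' := by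
  rw [← ha C' h, ← hb C' h]
  rfl

/-- Each branch is required to be correct only under its own outcome of the test, so the case
distinctions of a definition can be matched branch by branch. -/
theorem Den.ite (ha : Den m C a s) (hb : Den m C b t) (hx : s < t → Den m C x v)
    (hy : ¬ s < t → Den m C y v) : Den m C (.ite a b x y) v := by
  intro C' h
  rw [value_ite ha hb h]
  split_ifs with hst
  · exact hx hst C' h
  · exact hy hst C' h

theorem Decides.ite (ha : Den m C a s) (hb : Den m C b t) (hx : s < t → Decides m C x Q)
    (hy : ¬ s < t → Decides m C y Q) : Decides m C (.ite a b x y) Q := by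
  intro C' h
  rw [value_ite ha hb h]
  split_ifs with hst
  · exact hx hst C' h
  · exact hy hst C' h

theorem Den.eq (ha : Den m C a s) (hb : Den m C b t) (hx : s = t → Den m C x v)
    (hy : s ≠ t → Den m C y v) : Den m C (.eq a b x y) v :=
  .ite ha hb (fun h => hy h.ne) fun h => .ite hb ha (fun h' => hy h'.ne') fun h' =>
    hx (le_antisymm (not_lt.1 h') (not_lt.1 h))

theorem Den.sum {j : Bool} {f : Gen → Gen} {g : ℕ → ℕ}
    (h : ∀ C', C ≤ C' → ∀ X i, i < m (Expr.cell j) → Den m C' X i → Den m C' (f X) (g i)) :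
    Den m C (.sum j f) (∑ i ∈ range (m (Expr.cell j)), g i) := by
  intro C' hC
  change ∑ i ∈ range (m (Expr.cell j)), (f fun _ => .var C'.depth).value m (C'.push i) = _
  refine sum_congr rfl fun i hi => ?_
  exact h (C'.push i) (hC.trans (C'.le_push i)) _ i (mem_range.1 hi) (den_var C' i) _
    le_rfl

/-- Bounded search: a sum of natural numbers is positive exactly if a term is. The size of the sum
is irrelevant. -/
theorem Decides.sum {j : Bool} {f : Gen → Gen} {P : ℕ → Prop}
    (h : ∀ C', C ≤ C' → ∀ X i, i < m (Expr.cell j) → Den m C' X i → Decides m C' (f X) (P i)) :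
    Decides m C (.sum j f) (∃ i < m (Expr.cell j), P i) := by
  intro C' hC
  have key : ∀ i < m (Expr.cell j), (0 < (f fun _ => .var C'.depth).value m (C'.push i) ↔ P i) :=
    fun i hi => h (C'.push i) (hC.trans (C'.le_push i)) _ i hi (den_var C' i) _ le_rfl
  change 0 < ∑ i ∈ range (m (Expr.cell j)), (f fun _ => .var C'.depth).value m (C'.push i) ↔ _
  rw [Nat.pos_iff_ne_zero, ne_eq, sum_eq_zero_iff]
  push Not
  constructor
  · rintro ⟨i, hi, h0⟩
    exact ⟨i, mem_range.1 hi, (key i (mem_range.1 hi)).1 (Nat.pos_of_ne_zero h0)⟩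
  · rintro ⟨i, hi, hP⟩
    exact ⟨i, mem_range.2 hi, ((key i hi).2 hP).ne'⟩

/-- Binding evaluates `x` once, which keeps its cost from being multiplied by the loops inside `f`.
-/
theorem Den.bind {f : Gen → Gen} (hx : Den m C x w)
    (h : ∀ C', C ≤ C' → ∀ X, Den m C' X w → Den m C' (f X) v) : Den m C (.bind x f) v := by
  intro C' hC
  have := h (C'.push (x.value m C')) (hC.trans (C'.le_push _)) _
    (by rw [← hx C' hC]; exact den_var C' _) _ le_rfl
  exact this

theorem Decides.bind {f : Gen → Gen} (hx : Den m C x w)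
    (h : ∀ C', C ≤ C' → ∀ X, Den m C' X w → Decides m C' (f X) Q) :
    Decides m C (.bind x f) Q := by
  intro C' hC
  have := h (C'.push (x.value m C')) (hC.trans (C'.le_push _)) _
    (by rw [← hx C' hC]; exact den_var C' _) _ le_rfl
  exact this

theorem Decides.add (hx : Decides m C x Q) (hy : Decides m C y R) :
    Decides m C (x.add y) (Q ∨ R) := by
  intro C' h
  rw [← hx C' h, ← hy C' h]
  change 0 < x.value m C' + y.value m C' ↔ _
  omega

end RAM

/-! ### The input in memory -/

namespace Gerrymandering

/-- The memory `mem` starts with the input. -/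
structure Encodes {n c : ℕ} (I : Instance n c) (mem : ℕ → ℕ) : Prop where
  card : mem 0 = n
  colors : mem 1 = c
  target : mem 2 = I.p
  parts : mem 3 = I.k
  weight : ∀ u : Fin n, mem (4 + u) = I.w u
  color : ∀ u : Fin n, mem (4 + n + u) = I.col u
  adj_of : ∀ u v : Fin n, I.G.Adj u v → mem (4 + n + n + u * n + v) = 1
  not_adj_of : ∀ u v : Fin n, ¬ I.G.Adj u v → mem (4 + n + n + u * n + v) = 0

theorem getD_flatten {n : ℕ} {l : List (List ℕ)} (hl : ∀ r ∈ l, r.length = n) (u v : ℕ)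
    (hv : v < n) (hu : u < l.length) : l.flatten.getD (u * n + v) 0 = (l[u]).getD v 0 := by
  induction l generalizing u with
  | nil => simp at hu
  | cons r l ih =>
    have hr := hl r (by simp)
    rw [List.flatten_cons]
    cases u with
    | zero =>
      rw [zero_mul, zero_add, List.getD_append _ _ _ _ (by omega)]
      rfl
    | succ u =>
      rw [List.getD_append_right _ _ _ _ (by rw [hr, Nat.succ_mul]; omega), hr]
      have : (u + 1) * n + v - n = u * n + v := by rw [Nat.succ_mul]; omega
      rw [this, ih (fun r hr => hl r (by simp [hr])) u (by simpa using hu)]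
      rfl

theorem encodes_encode {n c : ℕ} (I : Instance n c) : Encodes I fun i => I.encode.getD i 0 := by
  classical
  have hlen1 : (List.ofFn I.w).length = n := List.length_ofFn
  have hlen2 : (List.ofFn fun v => (I.col v : ℕ)).length = n := List.length_ofFn
  have hadj : ∀ u v : Fin n, I.encode.getD (4 + n + n + u * n + v) 0 =
      if I.G.Adj u v then 1 else 0 := by
    intro u v
    rw [Instance.encode, List.getD_append_right _ _ _ _ (by simp; omega)]
    have : 4 + n + n + (u : ℕ) * n + v - ([n, c, (I.p : ℕ), I.k] ++ List.ofFn I.w ++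
        List.ofFn fun v => (I.col v : ℕ)).length = u * n + v := by
      simp only [List.length_append, hlen1, hlen2, List.length_cons, List.length_nil]; omega
    rw [this, getD_flatten (n := n) (by simp [List.mem_ofFn]) u v v.2 (by simp)]
    simp
  refine ⟨rfl, rfl, rfl, rfl, fun u => ?_, fun u => ?_, fun u v h => ?_, fun u v h => ?_⟩
  · rw [Instance.encode, List.append_assoc, List.append_assoc,
      List.getD_append_right _ _ _ _ (by simp), List.getD_append _ _ _ _ (by simp)]
    simp
  · rw [Instance.encode, List.getD_append _ _ _ _ (by simp; omega),
      List.getD_append_right _ _ _ _ (by simp; omega)]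
    have : 4 + n + (u : ℕ) - ([n, c, (I.p : ℕ), I.k] ++ List.ofFn I.w).length = u := by
      simp only [List.length_append, hlen1, List.length_cons, List.length_nil]; omega
    rw [this]
    simp
  · rw [hadj, if_pos h]
  · rw [hadj, if_neg h]

end Gerrymandering

/-! ### The algorithm as an expression -/

namespace Gerrymandering

open Finset

open RAM

/-! The program, in the language of expressions with bounded sums. -/

def nGen : Gen := .mem (.lit 0)
def cGen : Gen := .mem (.lit 1)
def pGen : Gen := .mem (.lit 2)
def kGen : Gen := .mem (.lit 3)
def wGen (u : Gen) : Gen := .mem (.add (.lit 4) u)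
def colGen (u : Gen) : Gen := .mem (.add (.add (.lit 4) nGen) u)

/-- The centers, the address of the row of the first one in the adjacency matrix, and the number of
stars. -/
structure Centers where
  A : Gen
  B : Gen
  R : Gen
  M : Gen

namespace Centers

variable (P : Centers)

/-- No loop is needed, because `R` already holds the address of the row of the first center. -/
def star (u : Gen) : Gen :=
  .ite P.M (.lit 2) (.lit 0) (.eq u P.B (.lit 1) (.eq u P.A (.lit 0)
    (.sub (.lit 1) (.mem (.add P.R u)))))

def ctr (u x y : Gen) : Gen := .eq u P.A x (.eq u P.B x y)

def lt (u v x y : Gen) : Gen :=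
  P.ctr v x (.ite (wGen u) (wGen v) x (.ite (wGen v) (wGen u) y (.ite u v x y)))

def base (i r : Gen) : Gen := .sum false fun u =>
  P.ctr u (.eq (P.star u) i (.eq (colGen u) r (wGen u) (.lit 0)) (.lit 0)) (.lit 0)

def upto (u : Gen) : Gen := .sum false fun u' =>
  .eq (P.star u') (P.star u) (.eq (colGen u') (colGen u)
    (P.ctr u' (wGen u') (P.lt u u' (.lit 0) (wGen u'))) (.lit 0)) (.lit 0)

def threshold (i v : Gen) : Gen := .sum false fun u =>
  .eq (P.star u) i (.eq (colGen u) (colGen v)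
    (P.ctr u (wGen u) (P.lt u v (.lit 0) (wGen u))) (.lit 0)) (.lit 0)

/-- Selection by the star of `u`. -/
def pick (u x y : Gen) : Gen := .eq (P.star u) (.lit 0) x y

def guard (u r x : Gen) : Gen :=
  P.ctr u (.lit 0) (.eq (wGen u) (.lit 0) (.lit 0) (.eq (colGen u) r x (.lit 0)))

def zeros : Gen := .sum false fun u =>
  P.ctr u (.lit 0) (.eq (wGen u) (.lit 0) (.lit 1) (.lit 0))

end Centers

/-- The guessed vertices, maximum weights and winners of the two stars. -/
structure Guess where
  V₀ : Gen
  V₁ : Gen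
  T₀ : Gen
  T₁ : Gen
  Q₀ : Gen
  Q₁ : Gen

def pwinGen (Q : Gen) : Gen := .eq Q pGen (.lit 1) (.lit 0)

namespace Guess

variable (P : Centers) (G : Guess)

def below (u r x : Gen) : Gen :=
  P.guard u r (.eq r (P.pick u G.Q₀ G.Q₁) (P.lt u (P.pick u G.V₀ G.V₁) (.lit 1) (.lit 0)) x)

def lo (r : Gen) : Gen := .sum false fun u => G.below P u r
  (.ite (P.pick u G.T₀ G.T₁) (.add (P.upto u) (P.pick u (pwinGen G.Q₀) (pwinGen G.Q₁)))
    (.lit 1) (.lit 0))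

def mid (r : Gen) : Gen := .sum false fun u => G.below P u r
  (.ite (P.upto u) (P.pick u G.T₀ G.T₁) (.lit 0) (.lit 1))

def hi (r : Gen) : Gen := .sum false fun u => G.below P u r (.lit 1)

def tie (i Q T r : Gen) : Gen := .eq r Q (.lit 1) (.ite (P.base i r) T (.lit 0) (.lit 1))

def ties (r : Gen) : Gen := .add (tie P (.lit 0) G.Q₀ G.T₀ r) (tie P (.lit 1) G.Q₁ G.T₁ r)

def exceeds (i Q T r : Gen) : Gen :=
  .eq r Q (.lit 0) (.ite T (.add (P.base i r) (pwinGen Q)) (.lit 1) (.lit 0))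

/-- The number of violations of the conditions on the single colors. -/
def violations (d : Gen) : Gen := .sum true fun r =>
  .add (.add (exceeds P (.lit 0) G.Q₀ G.T₀ r) (exceeds P (.lit 1) G.Q₁ G.T₁ r))
    (.eq r pGen (.lit 0) (.ite d (.add (G.mid P r) (G.ties P r)) (.lit 1) (.lit 0)))

def sumLo : Gen := .sum true fun r => .eq r pGen (.lit 0) (G.lo P r)

def sumHi (d : Gen) : Gen := .sum true fun r => .eq r pGen (.lit 0)
  (.bind (G.hi P r) fun x => .bind (.sub d (G.ties P r)) fun y => .ite x y x y)

/-- Everything independent of `z` is bound before the innermost loop, whose body then takes constant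
time. -/
def check : Gen := .sum false fun d => .ite (G.violations P d) (.lit 1)
  (.bind (G.lo P pGen) fun l => .bind (G.hi P pGen) fun h =>
    .bind (G.sumLo P) fun L => .bind (G.sumHi P d) fun H => .bind P.zeros fun Z =>
    .bind (.add (pwinGen G.Q₀) (pwinGen G.Q₁)) fun W => .sum false fun z =>
      .bind (.add (.add d (.lit 1)) z) fun E =>
        .ite Z z (.lit 0) (.ite E (.add l W) (.lit 0) (.ite (.add h W) E (.lit 0)
          (.ite (.add kGen W) (.add (.add (.add L E) z) P.M) (.lit 0)
            (.ite (.add (.add (.add H E) z) P.M) (.add kGen W) (.lit 0) (.lit 1))))))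
  (.lit 0)

end Guess

/-- The search for a certificate. -/
def Centers.search (P : Centers) : Gen := .sum false fun v₀ => .sum false fun v₁ =>
  .bind (P.threshold (.lit 0) v₀) fun t₀ =>
  .bind (.ite P.M (.lit 2) (.lit 1) (P.threshold (.lit 1) v₁)) fun t₁ =>
  .bind (.eq t₀ (.lit 0) cGen (colGen v₀)) fun q₀ =>
  .bind (.ite P.M (.lit 2) cGen (.eq t₁ (.lit 0) cGen (colGen v₁))) fun q₁ =>
  Guess.check P ⟨v₀, v₁, t₀, t₁, q₀, q₁⟩

/-- For lack of multiplication, `u * n` is obtained by adding `n` once for each `i < u`. -/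
def rowGen (u : Gen) : Gen :=
  .add (.add (.add (.lit 4) nGen) nGen) (.sum false fun i => .ite i u nGen (.lit 0))

/-- A case distinction on whether a vertex has at least two neighbors. -/
def innerGen (u x y : Gen) : Gen :=
  .bind (rowGen u) fun R => .ite (.sum false fun v => .mem (.add R v)) (.lit 2) y x

/-- Sum over the pairs of vertices with at least two neighbors each. -/
def centerGen (f : Gen → Gen → Gen) : Gen := .sum false fun u => .sum false fun v =>
  .ite u v (innerGen u (innerGen v (f u v) (.lit 0)) (.lit 0)) (.lit 0)

/-- Just one pair of vertices passes the tests in `centerGen`, so each of the two sums returns a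
center. One color is handled separately, since certificates are complete only for two or more. -/
def solver : Gen :=
  .bind (centerGen fun u _ => u) fun a => .bind (centerGen fun _ v => v) fun b =>
  .bind (rowGen a) fun R => .ite cGen (.lit 2)
    (.ite (.lit 0) kGen (.ite nGen kGen (.lit 0) (.lit 1)) (.lit 0))
    (.add (Centers.search ⟨a, b, R, .lit 1⟩) (Centers.search ⟨a, b, R, .lit 2⟩))

/-- The five nested sums over vertices come from `v₀`, `v₁`, `d`, the leaf in `lo` or `mid`, and the
sum in `upto`. Sums over colors are never nested in each other. -/
theorem deg_solver : (solver 0).deg false ≤ 5 ∧ (solver 0).deg true ≤ 2 := by decide +kernel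

end Gerrymandering

/-! ### Correctness of the search for a certificate -/

namespace Gerrymandering

open Finset

open RAM

variable {n c : ℕ} {I : Instance n c} {mem : ℕ → ℕ} {C : Ctx}

theorem _root_.RAM.Den.of_eq {x : Gen} {v w : ℕ} (h : Den mem C x v) (e : v = w) : Den mem C x w :=
  e ▸ h

theorem den_sum_fin (hM : Encodes I mem) {f : Gen → Gen} {g : Fin n → ℕ}
    (h : ∀ C', C ≤ C' → ∀ X (u : Fin n), Den mem C' X u → Den mem C' (f X) (g u)) :
    Den mem C (.sum false f) (∑ u, g u) := by
  have hn : mem (Expr.cell false) = n := hM.card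
  have := Den.sum (m := mem) (C := C) (j := false) (f := f)
    (g := fun i => if hi : i < n then g ⟨i, hi⟩ else 0) fun C' hC X i hi hX => by
      rw [hn] at hi
      simp only [hi, dif_pos]
      exact h C' hC X ⟨i, hi⟩ hX
  rw [hn, sum_range] at this
  simpa using this

theorem den_sum_color (hM : Encodes I mem) {f : Gen → Gen} {g : ℕ → ℕ}
    (h : ∀ C', C ≤ C' → ∀ X r, r < c → Den mem C' X r → Den mem C' (f X) (g r)) :
    Den mem C (.sum true f) (∑ r ∈ range c, g r) := by
  have hc : mem (Expr.cell true) = c := hM.colors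
  have := Den.sum (m := mem) (C := C) (j := true) (f := f) (g := g)
  rw [hc] at this
  exact this h

theorem decides_sum (hM : Encodes I mem) {f : Gen → Gen} {Q : ℕ → Prop}
    (h : ∀ C', C ≤ C' → ∀ X i, Den mem C' X i → Decides mem C' (f X) (Q i)) :
    Decides mem C (.sum false f) (∃ i < n, Q i) := by
  have hn : mem (Expr.cell false) = n := hM.card
  have := Decides.sum (m := mem) (C := C) (j := false) (f := f) (P := Q)
    fun C' hC X i _ => h C' hC X i
  rwa [hn] at this

theorem decides_sum_fin (hM : Encodes I mem) {f : Gen → Gen} {Q : Fin n → Prop}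
    (h : ∀ C', C ≤ C' → ∀ X (u : Fin n), Den mem C' X u → Decides mem C' (f X) (Q u)) :
    Decides mem C (.sum false f) (∃ u, Q u) := by
  have hn : mem (Expr.cell false) = n := hM.card
  have := Decides.sum (m := mem) (C := C) (j := false) (f := f)
    (P := fun i => ∃ hi : i < n, Q ⟨i, hi⟩) fun C' hC X i hi hX => by
      rw [hn] at hi
      exact (h C' hC X ⟨i, hi⟩ hX).of_iff ⟨fun hQ => ⟨hi, hQ⟩, fun ⟨_, hQ⟩ => hQ⟩
  refine this.of_iff ⟨fun ⟨i, _, hi, hQ⟩ => ⟨⟨i, hi⟩, hQ⟩, fun ⟨u, hQ⟩ => ⟨u, ?_, u.2, hQ⟩⟩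
  rw [hn]
  exact u.2

section
variable (hM : Encodes I mem)
include hM

theorem den_n : Den mem C nGen n := by
  have := (den_lit (m := mem) (C := C) 0).mem
  rwa [hM.card] at this

theorem den_c : Den mem C cGen c := by
  have := (den_lit (m := mem) (C := C) 1).mem
  rwa [hM.colors] at this

theorem den_p : Den mem C pGen I.p := by
  have := (den_lit (m := mem) (C := C) 2).mem
  rwa [hM.target] at this

theorem den_k : Den mem C kGen I.k := by
  have := (den_lit (m := mem) (C := C) 3).mem
  rwa [hM.parts] at this

theorem den_w {x : Gen} {u : Fin n} (hu : Den mem C x u) : Den mem C (wGen x) (I.w u) := by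
  have := ((den_lit 4).add hu).mem
  rwa [hM.weight] at this

theorem den_col {x : Gen} {u : Fin n} (hu : Den mem C x u) : Den mem C (colGen x) (I.col u) := by
  have := (((den_lit 4).add (den_n hM)).add hu).mem
  rwa [hM.color] at this

theorem den_row {x : Gen} {u : Fin n} (hu : Den mem C x u) :
    Den mem C (rowGen x) (4 + n + n + u * n) := by
  refine (((den_lit 4).add (den_n hM)).add (den_n hM)).add ?_
  have h : (u : ℕ) * n = ∑ i : Fin n, if (i : ℕ) < u then n else 0 := by
    simp only [← Fin.lt_def]
    rw [← sum_filter, sum_const, filter_gt_eq_Iio, Fin.card_Iio, smul_eq_mul]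
  rw [h]
  refine den_sum_fin hM fun C' hC X i hX => .ite hX (hu.mono hC) (fun h => ?_) fun h => ?_
  · rw [if_pos h]; exact den_n hM
  · rw [if_neg h]; exact den_lit 0

end

theorem stars_s_lt (a b : Fin n) (m : ℕ) (u : Fin n) : (I.stars a b m).s u < 2 := by
  simp only [Instance.stars]
  split_ifs <;> omega

/-- This reduces the search for a function `v` to a search for two vertices. -/
theorem _root_.StarSystem.IsCertificate.congr {D : StarSystem n} {v v' : ℕ → Fin n} {k d z : ℕ}
    (h : D.IsCertificate v k d z) (hs : ∀ u, D.s u < 2) (hm : D.m ≤ 2)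
    (hv : ∀ i < 2, v i = v' i) : D.IsCertificate v' k d z := by
  have ht : D.top v = D.top v' := by
    funext i
    by_cases hi : i < D.m
    · rw [StarSystem.top, StarSystem.top, hv i (by omega)]
    · rw [StarSystem.top, StarSystem.top, if_neg hi, if_neg hi]
  have hw : D.winner v = D.winner v' := by
    funext i
    by_cases hi : i < D.m
    · rw [StarSystem.winner, StarSystem.winner, hv i (by omega)]
    · rw [StarSystem.winner, StarSystem.winner, if_neg fun e => hi e.1, if_neg fun e => hi e.1]
  have hp : D.pwin v = D.pwin v' := by funext i; rw [StarSystem.pwin, StarSystem.pwin, hw]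
  have hti : D.ties v = D.ties v' := by funext r; rw [StarSystem.ties, StarSystem.ties, hw, ht]
  have hvs : ∀ u, v (D.s u) = v' (D.s u) := fun u => hv _ (hs u)
  have hlo : D.lo v = D.lo v' := by
    funext r; simp only [StarSystem.lo, hw, ht, hp, hvs]
  have hmid : D.mid v = D.mid v' := by funext r; simp only [StarSystem.mid, hw, ht, hvs]
  have hhi : D.hi v = D.hi v' := by funext r; simp only [StarSystem.hi, hw, hvs]
  obtain ⟨h1, h2, h3, h4, h5, h6, h7⟩ := h
  rw [hw, hp, ht] at h1
  rw [hmid, hti] at h2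
  rw [hlo, hp] at h4 h6
  rw [hhi, hp] at h5 h7
  rw [hti] at h7
  exact ⟨h1, h2, h3, h4, h5, h6, h7⟩

/-- The expressions in `P` denote the centers `a` and `b`, the address of the row of `a`, and `m`. -/
structure Centers.Denotes (mem : ℕ → ℕ) (C : Ctx) (P : Centers) (a b : Fin n) (m : ℕ) : Prop where
  A : Den mem C P.A a
  B : Den mem C P.B b
  R : Den mem C P.R (4 + n + n + a * n)
  M : Den mem C P.M m

namespace Centers

variable {P : Centers} {a b : Fin n} {m : ℕ}

theorem Denotes.mono (h : P.Denotes mem C a b m) {C' : Ctx} (hC : C ≤ C') :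
    P.Denotes mem C' a b m := ⟨h.A.mono hC, h.B.mono hC, h.R.mono hC, h.M.mono hC⟩

variable (hM : Encodes I mem) (h : P.Denotes mem C a b m)
include h

theorem den_ctr {x y z : Gen} {u : Fin n} {v : ℕ} (hu : Den mem C x u)
    (hy : u ∈ (I.stars a b m).ctr → Den mem C y v) (hz : u ∉ (I.stars a b m).ctr → Den mem C z v) :
    Den mem C (P.ctr x y z) v := by
  simp only [Instance.stars, mem_insert, mem_singleton, Fin.ext_iff, not_or] at hy hz
  exact .eq hu h.A (fun e => hy (.inl e)) fun e => .eq hu h.B (fun e' => hy (.inr e')) fun e' =>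
    hz ⟨e, e'⟩

include hM

theorem den_star {x : Gen} {u : Fin n} (hu : Den mem C x u) :
    Den mem C (P.star x) ((I.stars a b m).s u) := by
  classical
  have hs : (I.stars a b m).s u = if m < 2 then 0 else if u = b then 1 else if u = a then 0 else
    if I.G.Adj a u then 0 else 1 := by simp only [Instance.stars]
  rw [hs]
  refine .ite h.M (den_lit 2) (fun h1 => ?_) fun h1 => .eq hu h.B (fun h2 => ?_) fun h2 =>
    .eq hu h.A (fun h3 => ?_) fun h3 => ?_
  · rw [if_pos h1]; exact den_lit 0
  · rw [if_neg h1, if_pos (Fin.ext h2)]; exact den_lit 1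
  · rw [if_neg h1, if_neg (fun e => h2 (congrArg _ e)), if_pos (Fin.ext h3)]; exact den_lit 0
  · rw [if_neg h1, if_neg (fun e => h2 (congrArg _ e)), if_neg (fun e => h3 (congrArg _ e))]
    have := (den_lit 1).sub (h.R.add hu).mem
    by_cases hadj : I.G.Adj a u
    · rw [hM.adj_of a u hadj] at this
      rwa [if_pos hadj]
    · rw [hM.not_adj_of a u hadj] at this
      rwa [if_neg hadj]

theorem den_lt {x y s t : Gen} {u u' : Fin n} {v : ℕ} (hu : Den mem C x u) (hu' : Den mem C y u')
    (hs : (I.stars a b m).lt u u' → Den mem C s v)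
    (ht : ¬ (I.stars a b m).lt u u' → Den mem C t v) : Den mem C (P.lt x y s t) v := by
  have hw : (I.stars a b m).w = I.w := rfl
  simp only [StarSystem.lt, hw, Fin.lt_def] at hs ht
  refine den_ctr h hu' (fun e => hs (.inl e)) fun e => .ite (den_w hM hu) (den_w hM hu')
    (fun e1 => hs (.inr (.inl e1))) fun e1 => .ite (den_w hM hu') (den_w hM hu)
    (fun e2 => ht ?_) fun e2 => .ite hu hu'
    (fun e3 => hs (.inr (.inr ⟨by omega, e3⟩))) fun e3 => ht ?_
  · rintro (h' | h' | h')
    · exact e h'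
    · exact e1 h'
    · omega
  · rintro (h' | h' | h')
    · exact e h'
    · exact e1 h'
    · exact e3 h'.2

theorem den_base {x y : Gen} {i r : ℕ} (hi : Den mem C x i) (hr : Den mem C y r) :
    Den mem C (P.base x y) ((I.stars a b m).base i r) := by
  rw [StarSystem.base, sum_filter]
  refine den_sum_fin hM fun C' hC X u hX => ?_
  have h' := h.mono hC
  exact den_ctr h' hX
    (fun h1 => .eq (den_star hM h' hX) (hi.mono hC)
      (fun h2 => .eq (den_col hM hX) (hr.mono hC)
        (fun h3 => (den_w hM hX).of_eq (if_pos ⟨h1, h2, h3⟩).symm)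
        fun h3 => (den_lit 0).of_eq (if_neg fun e => h3 e.2.2).symm)
      fun h2 => (den_lit 0).of_eq (if_neg fun e => h2 e.2.1).symm)
    fun h1 => (den_lit 0).of_eq (if_neg fun e => h1 e.1).symm

theorem den_upto {x : Gen} {u : Fin n} (hu : Den mem C x u) :
    Den mem C (P.upto x) ((I.stars a b m).upto u) := by
  rw [StarSystem.upto, sum_filter]
  refine den_sum_fin hM fun C' hC X u' hX => ?_
  have h' := h.mono hC
  have hu := hu.mono hC
  exact .eq (den_star hM h' hX) (den_star hM h' hu)
    (fun h1 => .eq (den_col hM hX) (den_col hM hu)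
      (fun h2 => den_ctr h' hX
        (fun h3 => (den_w hM hX).of_eq (if_pos ⟨h1, h2, .inl h3⟩).symm)
        fun h3 => den_lt hM h' hu hX
          (fun h4 => (den_lit 0).of_eq (if_neg fun e => e.2.2.elim h3 fun e => e h4).symm)
          fun h4 => (den_w hM hX).of_eq (if_pos ⟨h1, h2, .inr h4⟩).symm)
      fun h2 => (den_lit 0).of_eq (if_neg fun e => h2 e.2.1).symm)
    fun h1 => (den_lit 0).of_eq (if_neg fun e => h1 e.1).symm

theorem den_threshold {x y : Gen} {i : ℕ} {w : Fin n} (hi : Den mem C x i) (hw : Den mem C y w) :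
    Den mem C (P.threshold x y) ((I.stars a b m).threshold i w) := by
  rw [StarSystem.threshold, sum_filter]
  refine den_sum_fin hM fun C' hC X u hX => ?_
  have h' := h.mono hC
  have hw := hw.mono hC
  exact .eq (den_star hM h' hX) (hi.mono hC)
    (fun h1 => .eq (den_col hM hX) (den_col hM hw)
      (fun h2 => den_ctr h' hX
        (fun h3 => (den_w hM hX).of_eq (if_pos ⟨h1, h2, .inl h3⟩).symm)
        fun h3 => den_lt hM h' hX hw
          (fun h4 => (den_lit 0).of_eq (if_neg fun e => e.2.2.elim h3 fun e => e h4).symm)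
          fun h4 => (den_w hM hX).of_eq (if_pos ⟨h1, h2, .inr h4⟩).symm)
      fun h2 => (den_lit 0).of_eq (if_neg fun e => h2 e.2.1).symm)
    fun h1 => (den_lit 0).of_eq (if_neg fun e => h1 e.1).symm

/-- The function `f` stands for `top`, `winner`, `pwin` or `v`, each evaluated at the star of `u`.
-/
theorem den_pick {x y z : Gen} {u : Fin n} (f : ℕ → ℕ) (hu : Den mem C x u)
    (hy : Den mem C y (f 0)) (hz : Den mem C z (f 1)) :
    Den mem C (P.pick x y z) (f ((I.stars a b m).s u)) := by
  have hs : (I.stars a b m).s u = 0 ∨ (I.stars a b m).s u = 1 := by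
    simp only [Instance.stars]
    split_ifs <;> simp
  refine .eq (den_star hM h hu) (den_lit 0) (fun e => e ▸ hy) fun e => ?_
  rw [hs.resolve_left e]
  exact hz

theorem den_guard {x y z : Gen} {u : Fin n} {r : ℕ} {Q : Prop} [Decidable Q]
    (hu : Den mem C x u) (hr : Den mem C y r) (hz : Den mem C z (if Q then 1 else 0)) :
    Den mem C (P.guard x y z) (if u ∉ (I.stars a b m).ctr ∧ (I.stars a b m).w u ≠ 0 ∧
      (I.stars a b m).col u = r ∧ Q then 1 else 0) :=
  den_ctr h hu (fun h1 => (den_lit 0).of_eq (if_neg fun e => e.1 h1).symm) fun h1 =>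
    .eq (den_w hM hu) (den_lit 0) (fun h2 => (den_lit 0).of_eq (if_neg fun e => e.2.1 h2).symm)
    fun h2 => .eq (den_col hM hu) hr
      (fun h3 => hz.of_eq (if_congr ⟨fun hQ => ⟨h1, h2, h3, hQ⟩, fun e => e.2.2.2⟩ rfl rfl))
      fun h3 => (den_lit 0).of_eq (if_neg fun e => h3 e.2.2.1).symm

theorem den_zeros : Den mem C P.zeros #(I.stars a b m).zeros := by
  rw [StarSystem.zeros, card_filter]
  refine den_sum_fin hM fun C' hC X u hX => ?_
  have h' := h.mono hC
  exact den_ctr h' hX (fun h1 => (den_lit 0).of_eq (if_neg fun e => e.1 h1).symm) fun h1 =>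
    .eq (den_w hM hX) (den_lit 0) (fun h2 => (den_lit 1).of_eq (if_pos ⟨h1, h2⟩).symm)
    fun h2 => (den_lit 0).of_eq (if_neg fun e => h2 e.2).symm

end Centers

namespace Guess

/-- The expressions in `G` denote the guesses given by `v`. -/
structure Denotes (mem : ℕ → ℕ) (C : Ctx) (G : Guess) (D : StarSystem n) (v : ℕ → Fin n) :
    Prop where
  V₀ : Den mem C G.V₀ (v 0)
  V₁ : Den mem C G.V₁ (v 1)
  T₀ : Den mem C G.T₀ (D.top v 0)
  T₁ : Den mem C G.T₁ (D.top v 1)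
  Q₀ : Den mem C G.Q₀ (D.winner v 0)
  Q₁ : Den mem C G.Q₁ (D.winner v 1)

variable {P : Centers} {G : Guess} {a b : Fin n} {m : ℕ} {v : ℕ → Fin n}

theorem Denotes.mono {D : StarSystem n} (h : G.Denotes mem C D v) {C' : Ctx} (hC : C ≤ C') :
    G.Denotes mem C' D v :=
  ⟨h.V₀.mono hC, h.V₁.mono hC, h.T₀.mono hC, h.T₁.mono hC, h.Q₀.mono hC, h.Q₁.mono hC⟩

variable (hM : Encodes I mem) (h : P.Denotes mem C a b m)
  (hG : G.Denotes mem C (I.stars a b m) v)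
include hM

theorem den_pwin {x : Gen} {i : ℕ} (hx : Den mem C x ((I.stars a b m).winner v i)) :
    Den mem C (pwinGen x) ((I.stars a b m).pwin v i) :=
  .eq hx (den_p hM) (fun e => (den_lit 1).of_eq (if_pos e).symm)
    fun e => (den_lit 0).of_eq (if_neg e).symm

include h

theorem den_tie {x y q t : Gen} {i r : ℕ} (hi : Den mem C x i) (hr : Den mem C y r)
    (hq : Den mem C q ((I.stars a b m).winner v i)) (ht : Den mem C t ((I.stars a b m).top v i)) :
    Den mem C (tie P x q t y) (if r = (I.stars a b m).winner v i ∨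
      (I.stars a b m).top v i ≤ (I.stars a b m).base i r then 1 else 0) :=
  .eq hr hq (fun e => (den_lit 1).of_eq (if_pos (.inl e)).symm) fun e =>
    .ite (Centers.den_base hM h hi hr) ht
      (fun e1 => (den_lit 0).of_eq (if_neg fun e2 => e2.elim e (not_le.2 e1)).symm)
      fun e1 => (den_lit 1).of_eq (if_pos (.inr (not_lt.1 e1))).symm

theorem den_exceeds {x y q t : Gen} {i r : ℕ} (hi : Den mem C x i) (hr : Den mem C y r)
    (hq : Den mem C q ((I.stars a b m).winner v i)) (ht : Den mem C t ((I.stars a b m).top v i)) :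
    Den mem C (exceeds P x q t y) (if r ≠ (I.stars a b m).winner v i →
      (I.stars a b m).base i r + (I.stars a b m).pwin v i ≤ (I.stars a b m).top v i
      then 0 else 1) :=
  .eq hr hq (fun e => (den_lit 0).of_eq (if_pos fun e' => absurd e e').symm) fun e =>
    .ite ht ((Centers.den_base hM h hi hr).add (den_pwin hM hq))
      (fun e1 => (den_lit 1).of_eq (if_neg fun e2 => not_lt.2 (e2 e) e1).symm)
      fun e1 => (den_lit 0).of_eq (if_pos fun _ => not_lt.1 e1).symm

include hG

theorem den_below {x y z : Gen} {u : Fin n} {r : ℕ} {Q : Prop} [Decidable Q] (hu : Den mem C x u)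
    (hr : Den mem C y r) (hz : Den mem C z (if Q then 1 else 0)) :
    Den mem C (G.below P x y z) (if u ∉ (I.stars a b m).ctr ∧ (I.stars a b m).w u ≠ 0 ∧
      (I.stars a b m).col u = r ∧ if r = (I.stars a b m).winner v ((I.stars a b m).s u) then
        (I.stars a b m).lt u (v ((I.stars a b m).s u)) else Q then 1 else 0) :=
  Centers.den_guard hM h hu hr <|
    .eq hr (Centers.den_pick hM h _ hu hG.Q₀ hG.Q₁)
      (fun e => Centers.den_lt hM h hu
        (Centers.den_pick hM h (fun i => (v i : ℕ)) hu hG.V₀ hG.V₁)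
        (fun e1 => (den_lit 1).of_eq (if_pos (by rwa [if_pos e])).symm)
        fun e1 => (den_lit 0).of_eq (if_neg (by rwa [if_pos e])).symm)
      fun e => hz.of_eq (if_congr (by rw [if_neg e]) rfl rfl)

theorem den_lo {x : Gen} {r : ℕ} (hr : Den mem C x r) :
    Den mem C (G.lo P x) #((I.stars a b m).lo v r) := by
  rw [StarSystem.lo, card_filter]
  refine den_sum_fin hM fun C' hC X u hX => ?_
  have h' := h.mono hC
  have hG' := hG.mono hC
  exact den_below hM h' hG' hX (hr.mono hC) <|
    .ite (Centers.den_pick hM h' _ hX hG'.T₀ hG'.T₁)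
      ((Centers.den_upto hM h' hX).add
        (Centers.den_pick hM h' _ hX (den_pwin hM hG'.Q₀) (den_pwin hM hG'.Q₁)))
      (fun e => (den_lit 1).of_eq (if_pos e).symm) fun e => (den_lit 0).of_eq (if_neg e).symm

theorem den_mid {x : Gen} {r : ℕ} (hr : Den mem C x r) :
    Den mem C (G.mid P x) #((I.stars a b m).mid v r) := by
  rw [StarSystem.mid, card_filter]
  refine den_sum_fin hM fun C' hC X u hX => ?_
  have h' := h.mono hC
  have hG' := hG.mono hC
  exact den_below hM h' hG' hX (hr.mono hC) <|
    .ite (Centers.den_upto hM h' hX) (Centers.den_pick hM h' _ hX hG'.T₀ hG'.T₁)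
      (fun e => (den_lit 0).of_eq (if_neg (not_le.2 e)).symm)
      fun e => (den_lit 1).of_eq (if_pos (not_lt.1 e)).symm

theorem den_hi {x : Gen} {r : ℕ} (hr : Den mem C x r) :
    Den mem C (G.hi P x) #((I.stars a b m).hi v r) := by
  rw [StarSystem.hi, card_filter]
  refine den_sum_fin hM fun C' hC X u hX => ?_
  refine (den_below (Q := True) hM (h.mono hC) (hG.mono hC) hX (hr.mono hC) (den_lit 1)).of_eq
    (if_congr ?_ rfl rfl)
  simp only [if_true_right]

theorem den_ties {x : Gen} {r : ℕ} (hr : Den mem C x r) :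
    Den mem C (G.ties P x) ((I.stars a b m).ties v r) := by
  rw [StarSystem.ties, sum_range_succ, sum_range_one]
  exact (den_tie hM h (den_lit 0) hr hG.Q₀ hG.T₀).add (den_tie hM h (den_lit 1) hr hG.Q₁ hG.T₁)

/-- Every summand is the indicator of a violated condition. Only whether the total vanishes matters,
so its value `V` is left unspecified. -/
theorem den_violations {x : Gen} {d : ℕ} (hd : Den mem C x d) :
    ∃ V, Den mem C (G.violations P x) V ∧ (V < 1 ↔ (∀ r < c, ∀ i < 2,
      r ≠ (I.stars a b m).winner v i →
        (I.stars a b m).base i r + (I.stars a b m).pwin v i ≤ (I.stars a b m).top v i) ∧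
      ∀ r < c, r ≠ I.p → #((I.stars a b m).mid v r) + (I.stars a b m).ties v r ≤ d) := by
  refine ⟨_, den_sum_color hM fun C' hC X r _ hX =>
    ((den_exceeds hM (h.mono hC) (den_lit 0) hX (hG.mono hC).Q₀ (hG.mono hC).T₀).add
      (den_exceeds hM (h.mono hC) (den_lit 1) hX (hG.mono hC).Q₁ (hG.mono hC).T₁)).add
      (w := if r ≠ I.p → #((I.stars a b m).mid v r) + (I.stars a b m).ties v r ≤ d then 0 else 1)
      (.eq hX (den_p hM) (fun e => (den_lit 0).of_eq (if_pos fun e' => absurd e e').symm) fun e =>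
        .ite (hd.mono hC) ((den_mid hM (h.mono hC) (hG.mono hC) hX).add
          (den_ties hM (h.mono hC) (hG.mono hC) hX))
        (fun e1 => (den_lit 1).of_eq (if_neg fun e2 => not_lt.2 (e2 e) e1).symm)
        fun e1 => (den_lit 0).of_eq (if_pos fun _ => not_lt.1 e1).symm), ?_⟩
  rw [Nat.lt_one_iff, sum_eq_zero_iff]
  simp only [mem_range, Nat.add_eq_zero_iff, ite_eq_left_iff, one_ne_zero, imp_false, not_not]
  constructor
  · intro H
    refine ⟨fun r hr i hi => ?_, fun r hr => (H r hr).2⟩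
    obtain rfl | rfl : i = 0 ∨ i = 1 := by omega
    · exact (H r hr).1.1
    · exact (H r hr).1.2
  · exact fun H r hr => ⟨⟨H.1 r hr 0 (by omega), H.1 r hr 1 (by omega)⟩, H.2 r hr⟩

theorem den_sumLo : Den mem C (G.sumLo P)
    (∑ r ∈ range c with r ≠ (I.p : ℕ), #((I.stars a b m).lo v r)) := by
  rw [sum_filter]
  exact den_sum_color hM fun C' hC X r _ hX => .eq hX (den_p hM)
    (fun e => (den_lit 0).of_eq (if_neg fun e' => e' e).symm) fun e =>
    (den_lo hM (h.mono hC) (hG.mono hC) hX).of_eq (if_pos e).symm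

theorem den_sumHi {x : Gen} {d : ℕ} (hd : Den mem C x d) : Den mem C (G.sumHi P x)
    (∑ r ∈ range c with r ≠ (I.p : ℕ),
      min #((I.stars a b m).hi v r) (d - (I.stars a b m).ties v r)) := by
  rw [sum_filter]
  refine den_sum_color hM fun C' hC X r _ hX => .eq hX (den_p hM)
    (fun e => (den_lit 0).of_eq (if_neg fun e' => e' e).symm) fun e => .of_eq ?_ (if_pos e).symm
  refine .bind (den_hi hM (h.mono hC) (hG.mono hC) hX) fun C₁ h₁ x hx => .bind
    ((hd.mono (hC.trans h₁)).sub (den_ties hM (h.mono (hC.trans h₁)) (hG.mono (hC.trans h₁))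
      (hX.mono h₁))) fun C₂ h₂ y hy => .ite (hx.mono h₂) hy (fun e => ?_) fun e => ?_
  · exact (hx.mono h₂).of_eq (min_eq_left e.le).symm
  · exact hy.of_eq (min_eq_right (not_lt.1 e)).symm

theorem decides_check : Decides mem C (G.check P)
    (∃ d < n, ∃ z < n, (I.stars a b m).IsCertificate v I.k d z) := by
  refine decides_sum hM fun C₁ h₁ d' d hd => ?_
  obtain ⟨V, hV, hV'⟩ := den_violations hM (h.mono h₁) (hG.mono h₁) hd
  -- A failed inequality gives the value zero and contradicts the corresponding field of a
  -- certificate.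
  have no : ∀ {C : Ctx} {Q : Prop}, ¬ Q → Decides mem C (.lit 0) Q := fun hQ =>
    (den_lit 0).decides.of_iff (iff_of_false (lt_irrefl 0) hQ)
  refine .ite hV (den_lit 1) (fun e => ?_) fun e => no ?_
  swap
  · rintro ⟨z, _, hc⟩
    exact e (hV'.2 ⟨hc.base_le, hc.mid_le⟩)
  have e' := hV'.1 e
  refine .bind (den_lo hM (h.mono h₁) (hG.mono h₁) (den_p hM)) fun C₂ h₂ l hl => ?_
  have h₂' := h₁.trans h₂
  refine .bind (den_hi hM (h.mono h₂') (hG.mono h₂') (den_p hM)) fun C₃ h₃ u hu => ?_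
  have h₃' := h₂'.trans h₃
  refine .bind (den_sumLo hM (h.mono h₃') (hG.mono h₃')) fun C₄ h₄ L hL => ?_
  have h₄' := h₃'.trans h₄
  refine .bind (den_sumHi hM (h.mono h₄') (hG.mono h₄') (hd.mono (h₂.trans (h₃.trans h₄))))
    fun C₅ h₅ H hH => ?_
  have h₅' := h₄'.trans h₅
  refine .bind (Centers.den_zeros hM (h.mono h₅')) fun C₆ h₆ Z hZ => ?_
  have h₆' := h₅'.trans h₆
  refine .bind ((den_pwin hM (hG.mono h₆').Q₀).add (den_pwin hM (hG.mono h₆').Q₁))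
    fun C₇ h₇ W hW => ?_
  refine decides_sum hM fun C₈ h₈ z' z hz => ?_
  refine .bind (((hd.mono (h₂.trans (h₃.trans (h₄.trans (h₅.trans (h₆.trans (h₇.trans h₈))))))).add
    (den_lit 1)).add hz) fun C₉ h₉ E hE => ?_
  have k₈ := h₈.trans h₉
  have k₇ := h₇.trans k₈
  have k₆ := h₆.trans k₇
  have k₅ := h₅.trans k₆
  have k₄ := h₄.trans k₅
  have k₃ := h₃.trans k₄
  have k := h₂.trans k₃
  have hz := hz.mono h₉
  have hW := hW.mono k₈
  have hZ := hZ.mono k₇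
  have hH := hH.mono k₆
  have hL := hL.mono k₅
  have hu := hu.mono k₄
  have hl := hl.mono k₃
  have hm := h.M.mono (h₁.trans k)
  refine .ite hZ hz (fun e => no fun hc => not_le.2 e hc.z_le) fun e₁ => ?_
  refine .ite hE (hl.add hW) (fun e => no fun hc => not_le.2 e hc.lo_le)
    fun e₂ => ?_
  refine .ite (hu.add hW) hE (fun e => no fun hc => not_le.2 e hc.le_hi)
    fun e₃ => ?_
  refine .ite ((den_k hM).add hW) (((hL.add hE).add hz).add hm)
    (fun e => no fun hc => not_le.2 e hc.sum_le) fun e₄ => ?_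
  refine .ite (((hH.add hE).add hz).add hm) ((den_k hM).add hW)
    (fun e => no fun hc => not_le.2 e hc.le_sum) fun e₅ => ?_
  exact (den_lit 1).decides.of_iff (iff_of_true one_pos
    ⟨e'.1, e'.2, not_lt.1 e₁, not_lt.1 e₂, not_lt.1 e₃, not_lt.1 e₄, not_lt.1 e₅⟩)

end Guess

/-- If `m = 1`, the second vertex plays no role: the bound and the winner of the absent star are the
defaults 1 and `c`. -/
theorem Centers.decides_search {P : Centers} {a b : Fin n} {m : ℕ} (hM : Encodes I mem)
    (h : P.Denotes mem C a b m) (hm : m = 1 ∨ m = 2) : Decides mem C P.search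
      (∃ v, ∃ d < n, ∃ z < n, (I.stars a b m).IsCertificate v I.k d z) := by
  set D := I.stars a b m with hD
  have hDm : D.m = m := rfl
  refine Decides.of_iff (Q := ∃ v₀ v₁ : Fin n, ∃ d < n, ∃ z < n,
    D.IsCertificate (fun i => if i = 0 then v₀ else v₁) I.k d z) ?_ ⟨?_, ?_⟩
  · refine decides_sum_fin hM fun C₁ h₁ x₀ v₀ hx₀ => decides_sum_fin hM fun C₂ h₂ x₁ v₁ hx₁ => ?_
    set v : ℕ → Fin n := fun i => if i = 0 then v₀ else v₁ with hv
    have k₂ := h₁.trans h₂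
    have ht₀ : D.top v 0 = D.threshold 0 v₀ := if_pos (by omega)
    refine .bind (w := D.top v 0) ((den_threshold hM (h.mono k₂) (den_lit 0) (hx₀.mono h₂)).of_eq
      ht₀.symm) fun C₃ h₃ t₀ hT₀ => ?_
    have k₃ := k₂.trans h₃
    refine .bind (w := D.top v 1) (.ite (h.mono k₃).M (den_lit 2)
      (fun e => (den_lit 1).of_eq (if_neg (by omega)).symm) fun e =>
      (den_threshold hM (h.mono k₃) (den_lit 1) (hx₁.mono h₃)).of_eq (if_pos (by omega)).symm)
      fun C₄ h₄ t₁ hT₁ => ?_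
    have hT₀ := hT₀.mono h₄
    refine .bind (w := D.winner v 0) (.eq hT₀ (den_lit 0)
      (fun e => (den_c hM).of_eq (if_neg (by rw [ht₀] at e; exact fun e' => e'.2 e)).symm) fun e =>
      (den_col hM (hx₀.mono (h₂.trans (h₃.trans h₄)))).of_eq
        (if_pos (by rw [ht₀] at e; exact ⟨by omega, e⟩)).symm) fun C₅ h₅ q₀ hQ₀ => ?_
    have k₅ := k₃.trans (h₄.trans h₅)
    refine .bind (w := D.winner v 1) (.ite (h.mono k₅).M (den_lit 2)
      (fun e => (den_c hM).of_eq (if_neg (by omega)).symm) fun e =>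
      .eq (hT₁.mono h₅) (den_lit 0)
        (fun e' => (den_c hM).of_eq (if_neg (by
          rw [StarSystem.top, if_pos (by omega)] at e'; exact fun e'' => e''.2 e')).symm)
        fun e' => (den_col hM (hx₁.mono (h₃.trans (h₄.trans h₅)))).of_eq (if_pos (by
          rw [StarSystem.top, if_pos (by omega)] at e'; exact ⟨by omega, e'⟩)).symm)
      fun C₆ h₆ q₁ hQ₁ => ?_
    exact Guess.decides_check hM (h.mono (k₅.trans h₆))
      ⟨hx₀.mono (h₂.trans (h₃.trans (h₄.trans (h₅.trans h₆)))),
        hx₁.mono (h₃.trans (h₄.trans (h₅.trans h₆))), hT₀.mono (h₅.trans h₆),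
        hT₁.mono (h₅.trans h₆), hQ₀.mono h₆, hQ₁⟩
  · rintro ⟨v₀, v₁, H⟩
    exact ⟨_, H⟩
  · rintro ⟨v, d, hd, z, hz, H⟩
    refine ⟨v 0, v 1, d, hd, z, hz, H.congr (stars_s_lt a b m)
      (by omega : D.m ≤ 2) fun i hi => ?_⟩
    obtain rfl | rfl : i = 0 ∨ i = 1 := by omega
    all_goals rfl

end Gerrymandering

/-! ### Finding the centers and deciding the instance -/

namespace Gerrymandering

open Finset

open RAM

variable {n c : ℕ} {I : Instance n c} {mem : ℕ → ℕ} {C : Ctx} {a b : Fin n}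

-- A leaf has only its center as neighbor, whereas a center has the other center and a leaf of its
-- own.
open Classical in
theorem one_lt_card_neighbors_iff (hG : I.G.IsDoubleStar a b) (u : Fin n) :
    1 < #{v | I.G.Adj u v} ↔ u = a ∨ u = b := by
  simp only [one_lt_card, mem_filter, mem_univ, true_and]
  constructor
  · rintro ⟨x, hx, y, hy, hxy⟩
    by_contra hu
    rw [not_or] at hu
    have hl := hG.leaf u hu.1 hu.2
    have hab : ∀ z, I.G.Adj u z → z = a ∨ z = b := fun z hz => by
      by_contra h
      rw [not_or] at h
      exact hG.not_adj u z hu.1 hu.2 h.1 h.2 hz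
    rcases hab x hx with rfl | rfl <;> rcases hab y hy with rfl | rfl <;> tauto
  · rintro (rfl | rfl)
    · obtain ⟨x, hxb, hx⟩ := hG.exists_left
      exact ⟨b, hG.adj, x, hx, hxb.symm⟩
    · obtain ⟨x, hxa, hx⟩ := hG.exists_right
      exact ⟨a, hG.adj.symm, x, hx, hxa.symm⟩

theorem den_inner (hM : Encodes I mem) (hG : I.G.IsDoubleStar a b) {x y z : Gen} {u : Fin n}
    {v : ℕ} (hu : Den mem C x u) (hy : u = a ∨ u = b → Den mem C y v)
    (hz : ¬ (u = a ∨ u = b) → Den mem C z v) : Den mem C (innerGen x y z) v := by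
  classical
  rw [← one_lt_card_neighbors_iff hG u] at hy hz
  refine .bind (den_row hM hu) fun C₁ h₁ R hR => .ite (s := #{v | I.G.Adj u v}) ?_ (den_lit 2)
    (fun e => (hz (by omega)).mono h₁) fun e => (hy (by omega)).mono h₁
  rw [card_filter]
  refine den_sum_fin hM fun C₂ h₂ X w hX => ((hR.mono h₂).add hX).mem.of_eq ?_
  split_ifs with h
  · exact hM.adj_of u w h
  · exact hM.not_adj_of u w h

/-- The condition `u < v` leaves `(a, b)` as the only pair of centers, so the sum has a single
relevant term. -/
theorem den_center (hM : Encodes I mem) (hG : I.G.IsDoubleStar a b) (hab : a < b)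
    {f : Gen → Gen → Gen} {F : Fin n → Fin n → ℕ}
    (hf : ∀ C' X Y u v, Den mem C' X (u : Fin n) → Den mem C' Y (v : Fin n) →
      Den mem C' (f X Y) (F u v)) : Den mem C (centerGen f) (F a b) := by
  have hsum : ∑ u, ∑ v, (if u < v ∧ (u = a ∨ u = b) ∧ (v = a ∨ v = b) then F u v else 0) =
      F a b := by
    rw [sum_eq_single a, sum_eq_single b]
    · rw [if_pos ⟨hab, .inl rfl, .inr rfl⟩]
    · intro v _ hv
      refine if_neg fun h => ?_
      rcases h.2.2 with rfl | rfl
      · exact lt_irrefl _ h.1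
      · exact hv rfl
    · simp
    · intro u _ hu
      refine sum_eq_zero fun v _ => if_neg fun h => ?_
      obtain rfl := h.2.1.resolve_left hu
      rcases h.2.2 with rfl | rfl
      · exact lt_asymm hab h.1
      · exact lt_irrefl _ h.1
    · simp
  rw [← hsum]
  refine den_sum_fin hM fun C₁ h₁ X u hX => den_sum_fin hM fun C₂ h₂ Y v hY => ?_
  have hX := hX.mono h₂
  exact .ite hX hY
    (fun h3 => den_inner hM hG hX
      (fun h4 => den_inner hM hG hY
        (fun h5 => (hf _ _ _ _ _ hX hY).of_eq (if_pos ⟨h3, h4, h5⟩).symm)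
        fun h5 => (den_lit 0).of_eq (if_neg fun e => h5 e.2.2).symm)
      fun h4 => (den_lit 0).of_eq (if_neg fun e => h4 e.2.1).symm)
    fun h3 => (den_lit 0).of_eq (if_neg fun e => h3 e.1).symm

theorem decides_solver (hM : Encodes I mem) (hG : I.G.IsDoubleStar a b) (hab : a < b) :
    Decides mem C solver I.IsYes := by
  refine .bind (den_center hM hG hab (F := fun u _ => (u : ℕ)) fun _ _ _ _ _ hX _ => hX)
    fun C₁ h₁ A hA => .bind (den_center hM hG hab (F := fun _ v => (v : ℕ))
      fun _ _ _ _ _ _ hY => hY) fun C₂ h₂ B hB =>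
    .bind (den_row hM (hA.mono h₂)) fun C₃ h₃ R hR =>
    .ite (den_c hM) (den_lit 2) (fun hc => ?_) fun hc => ?_
  · have hiff := isYes_iff_of_lt_two hG hc
    refine .ite (den_lit 0) (den_k hM) (fun h0 => .ite (den_n hM) (den_k hM) (fun hk => ?_)
      fun hk => ?_) fun h0 => ?_
    · exact (den_lit 0).decides.of_iff (iff_of_false (lt_irrefl 0) fun h => by
        have := hiff.1 h; omega)
    · exact (den_lit 1).decides.of_iff (iff_of_true one_pos (hiff.2 ⟨h0, by omega⟩))
    · exact (den_lit 0).decides.of_iff (iff_of_false (lt_irrefl 0) fun h => h0 (hiff.1 h).1)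
  · have hP : ∀ m, Centers.Denotes mem C₃ ⟨A, B, R, .lit m⟩ a b m := fun m =>
      ⟨hA.mono (h₂.trans h₃), hB.mono h₃, hR, den_lit m⟩
    refine ((Centers.decides_search hM (hP 1) (.inl rfl)).add
      (Centers.decides_search hM (hP 2) (.inr rfl))).of_iff ?_
    rw [isYes_iff_of_two_le hG (not_lt.1 hc)]
    constructor
    · rintro (⟨v, d, hd, z, hz, h⟩ | ⟨v, d, hd, z, hz, h⟩)
      · exact ⟨1, .inl rfl, v, d, z, hd, hz, h⟩
      · exact ⟨2, .inr rfl, v, d, z, hd, hz, h⟩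
    · rintro ⟨m, rfl | rfl, v, d, z, hd, hz, h⟩
      · exact .inl ⟨v, d, hd, z, hz, h⟩
      · exact .inr ⟨v, d, hd, z, hz, h⟩

end Gerrymandering

/-- One random access machine program decides Gerrymandering over Graphs on all trees of diameter
three, and it does so in `O(c ^ 2 * n ^ 5)` steps, where `n` is the number of vertices and `c` the
number of colors. -/
theorem proposition4 :
    ∃ (P : RAM.Prog) (K : ℕ), ∀ (n c : ℕ) (I : Gerrymandering.Instance n c),
      I.G.IsTree → I.G.diam = 3 →
        RAM.AnswersWithin P I.encode I.IsYes (K * (c ^ 2 * n ^ 5)) := by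
  refine ⟨RAM.Expr.decide (Gerrymandering.solver 0),
    RAM.Expr.factor (Gerrymandering.solver 0) + 3, fun n c I hT hd => ?_⟩
  -- The double star is symmetric in its centers, which may thus be ordered as the program finds
  -- them.
  obtain ⟨a, b, hG, hab⟩ : ∃ a b, I.G.IsDoubleStar a b ∧ a < b := by
    obtain ⟨a, b, hG⟩ := hT.exists_isDoubleStar hd
    rcases hG.adj.ne.lt_or_gt with h | h
    · exact ⟨a, b, hG, h⟩
    · exact ⟨b, a, hG.symm, h⟩
  have hM := Gerrymandering.encodes_encode I
  have hdeg := Gerrymandering.deg_solver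
  have hn : I.encode.getD 0 0 = n := hM.card
  have hc : I.encode.getD 1 0 = c := hM.colors
  -- Both bounds are positive because a vertex and a target color exist. The expression is closed,
  -- so the empty context suffices.
  have h := RAM.Expr.answersWithin_decide (Gerrymandering.solver 0) I.encode (fun _ => 0)
    (answer := I.IsYes) (by rw [hn]; exact a.pos) (by rw [hc]; exact I.p.pos) hdeg.1 hdeg.2
    (Gerrymandering.decides_solver hM hG hab ⟨0, fun _ => 0⟩ le_rfl).symm
  rwa [hn, hc] at h
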